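/- Let $p,n,M\in\mathbb N$, and for $l\le M$ let $\Sigma^{(l)}\in\mathbb R^{p\times p}$ and $\tilde\Sigma^{(l)}\in\mathbb R^{n\times n}$ be symmetric positive semi-definite matrices. Let $\mathbf H$ be a centred Gaussian random matrix in $\mathbb R^{p\times n}$ (its entries are jointly Gaussian with mean zero) with $$\mathrm{Cov}[\mathbf H_{ji},\mathbf H_{j'i'}]=\sum_{l=1}^M\Sigma^{(l)}_{jj'}\tilde\Sigma^{(l)}_{ii'}\qquad\text{for all } i,i'\le n,\ j,j'\le p,$$ and let $\mathbf h_1,\dots,\mathbf h_M$ in $\mathbb R^n$ and $\mathbf g_1,\dots,\mathbf g_M$ in $\mathbb R^p$ be independent standard Gaussian vectors. Let $\mathcal S_w\subset\mathbb R^p$ and $\mathcal S_u\subset\mathbb R^n$ be non-empty and compact, and let $f:\mathcal S_w\times\mathcal S_u\to\mathbb R$ be continuous. Write $\|v\|_{\Sigma}=\sqrt{v^\top\Sigma v}$ and, for $\mathcal S\subseteq\mathcal S_w$, $$\Psi_{\mathcal S,\mathcal S_u}=\min_{w\in\mathcal S}\max_{u\in\mathcal S_u}\big\{w^\top\mathbf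 Hu+f(w,u)\big\},$$ $$\psi_{\mathcal S,\mathcal S_u}=\min_{w\in\mathcal S}\max_{u\in\mathcal S_u}\Big\{\sum_{l=1}^M\Big(\|w\|_{\Sigma^{(l)}}\,\mathbf h_l^\top(\tilde\Sigma^{(l)})^{1/2}u+w^\top(\Sigma^{(l)})^{1/2}\mathbf g_l\,\|u\|_{\tilde\Sigma^{(l)}}\Big)+f(w,u)\Big\}.$$ (i) For all $c\in\mathbb R$, $\ \mathbb P(\Psi_{\mathcal S_w,\mathcal S_u}\le c)\le 2^M\,\mathbb P(\psi_{\mathcal S_w,\mathcal S_u}\le c)$. (ii) If in addition $\mathcal S_w$ and $\mathcal S_u$ are convex and $f$ is convex-concave on $\mathcal S_w\times\mathcal S_u$ (convex in $w$, concave in $u$), then for all $c\in\mathbb R$, $\ \mathbb P(\Psi_{\mathcal S_w,\mathcal S_u}\ge c)\le 2^M\,\mathbb P(\psi_{\mathcal S_w,\mathcal S_u}\ge c)$, and for all $\mu\in\mathbb R$ and $t>0$, $\ \mathbb P(|\Psi_{\mathcal S_w,\mathcal S_u}-\mu|\ge t)\le 2^M\,\mathbb P(|\psi_{\mathcal S_w,\mathcal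 S_u}-\mu|\ge t)$. (iii) Assume the conditions of (ii). Let $\mathcal A_p$ be a (relatively) open subset of $\mathcal S_w$, put $\mathcal A_p^c=\mathcal S_w\setminus\mathcal A_p$, and let $\hat w_\Psi$ be a minimizer over $w\in\mathcal S_w$ of $\max_{u\in\mathcal S_u}\{w^\top\mathbf Hu+f(w,u)\}$. If there are constants $\bar\psi_{\mathcal S_w},\bar\psi_{\mathcal A_p^c}\in\mathbb R$ and $\eta,\epsilon>0$ such that $$\bar\psi_{\mathcal A_p^c}\ge\bar\psi_{\mathcal S_w}+3\eta,\qquad \mathbb P(\psi_{\mathcal S_w,\mathcal S_u}\le\bar\psi_{\mathcal S_w}+\eta)\ge1-\epsilon,\qquad \mathbb P(\psi_{\mathcal A_p^c,\mathcal S_u}\ge\bar\psi_{\mathcal A_p^c}-\eta)\ge1-\epsilon,$$ then $\mathbb P(\hat w_\Psi\in\mathcal A_p)\ge1-2^{M+1}\epsilon$. -/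

import Mathlib

open MeasureTheory ProbabilityTheory Matrix
open scoped MatrixOrder

noncomputable section

namespace DependentCGMT

/-- The seminorm `‖v‖_S = √(vᵀ S v)` of a positive semi-definite matrix `S`. -/
def quadNorm {d : ℕ} (S : Matrix (Fin d) (Fin d) ℝ) (v : Fin d → ℝ) : ℝ :=
  Real.sqrt (v ⬝ᵥ (S *ᵥ v))

/-- The law of a standard Gaussian vector in `ℝᵈ`. -/
def stdGaussianVec (d : ℕ) : Measure (Fin d → ℝ) :=
  Measure.pi fun _ => gaussianReal 0 1

/-- The inner maximum `max_{u ∈ T} L(w, u)` as a function of `w`. It is a supremum, which is attained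
whenever `T` is compact and non-empty and `L(w, ·)` is continuous on `T`. -/
def innerMax {p n : ℕ} (T : Set (Fin n → ℝ)) (L : (Fin p → ℝ) → (Fin n → ℝ) → ℝ)
    (w : Fin p → ℝ) : ℝ :=
  ⨆ u : T, L w u

/-- The value `min_{w ∈ S} max_{u ∈ T} L(w, u)`. The extrema are attained whenever `S` and `T` are
compact and non-empty and `L` is continuous on `S × T`. -/
def minMax {p n : ℕ} (S : Set (Fin p → ℝ)) (T : Set (Fin n → ℝ))
    (L : (Fin p → ℝ) → (Fin n → ℝ) → ℝ) : ℝ :=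
  ⨅ w : S, innerMax T L w

/-- The primary loss `wᵀ H u + f(w, u)`. -/
def primaryLoss {p n : ℕ} (f : (Fin p → ℝ) → (Fin n → ℝ) → ℝ) (H : Matrix (Fin p) (Fin n) ℝ)
    (w : Fin p → ℝ) (u : Fin n → ℝ) : ℝ :=
  w ⬝ᵥ (H *ᵥ u) + f w u

/-- The auxiliary loss
`∑_l (‖w‖_{S_l} h_lᵀ T_l^{1/2} u + wᵀ S_l^{1/2} g_l ‖u‖_{T_l}) + f(w, u)`;
`CFC.sqrt` is the positive semi-definite square root. -/
def auxiliaryLoss {p n M : ℕ} (S : Fin M → Matrix (Fin p) (Fin p) ℝ)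
    (T : Fin M → Matrix (Fin n) (Fin n) ℝ) (f : (Fin p → ℝ) → (Fin n → ℝ) → ℝ)
    (h : Fin M → Fin n → ℝ) (g : Fin M → Fin p → ℝ)
    (w : Fin p → ℝ) (u : Fin n → ℝ) : ℝ :=
  (∑ l, (quadNorm (S l) w * (h l ⬝ᵥ (CFC.sqrt (T l) *ᵥ u))
      + (w ⬝ᵥ (CFC.sqrt (S l) *ᵥ g l)) * quadNorm (T l) u)) + f w u

/-- `H` is a centred Gaussian `p × n` matrix (its entries are jointly Gaussian) with
`Cov[H_{ji}, H_{j'i'}] = ∑_l (S_l)_{jj'} (T_l)_{ii'}`. -/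
structure IsLowRankGaussian {Ω : Type*} [MeasurableSpace Ω] (P : Measure Ω) {p n M : ℕ}
    (S : Fin M → Matrix (Fin p) (Fin p) ℝ) (T : Fin M → Matrix (Fin n) (Fin n) ℝ)
    (H : Ω → Matrix (Fin p) (Fin n) ℝ) : Prop where
  gaussian : HasGaussianLaw (fun ω => fun ji : Fin p × Fin n => H ω ji.1 ji.2) P
  centred : ∀ j i, ∫ ω, H ω j i ∂P = 0
  cov : ∀ j i j' i', covariance (fun ω => H ω j i) (fun ω => H ω j' i') P
    = ∑ l, S l j j' * T l i i'

/-- `h_1, …, h_M` in `ℝⁿ` and `g_1, …, g_M` in `ℝᵖ` are (mutually) independent standard Gaussian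
vectors: their joint law is the product of the standard Gaussian laws. -/
def IsIndepStdGaussian {Ω : Type*} [MeasurableSpace Ω] (P : Measure Ω) {p n M : ℕ}
    (h : Ω → Fin M → Fin n → ℝ) (g : Ω → Fin M → Fin p → ℝ) : Prop :=
  HasLaw (fun ω => (h ω, g ω))
    ((Measure.pi fun _ : Fin M => stdGaussianVec n).prod
      (Measure.pi fun _ : Fin M => stdGaussianVec p)) P

end DependentCGMT

end

noncomputable section

namespace DependentCGMT

/-! ### Gaussian integration by parts -/

/-! The argument is Gordon's Gaussian comparison, made applicable by an auxiliary Gaussian term and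
followed by minimax duality. For each `l`, add to `wᵀHu` an independent term `γ_l ‖w‖_{S_l}
‖u‖_{T_l}` with `γ_l` standard normal. The covariance of the enlarged process minus that of the
auxiliary process is then a sum over `l` of products of two Cauchy–Schwarz defects, one in `w` and
one in `u` (`primaryCov_add_normCov_sub`). It is nonnegative, and it vanishes when `w = w'`, which
is exactly Gordon's condition. Hence the min-max value of the enlarged process is less likely to
fall below `c` than that of the auxiliary process. With probability at least `2^{-M}` all `γ_l` are
nonpositive; on that independent event the added term can only lower the value. This gives the
lower-tail bound with the factor `2^M` (`measureReal_minMax_lt_le`).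

Gordon's inequality comes from interpolating between the two Gaussian vectors: by integration by
parts, the derivative of `E F` along the path is the covariance difference paired with the second
derivatives of `F` (`integral_le_integral_of_partialDeriv`). A smooth version of the indicator of `∀
a, ∃ b, c_{ab} < z_{ab}` has nonnegative mixed derivatives across different rows, and pairs in one
row carry zero weight. Dense sequences and compactness carry the finite inequality to continuous
processes on `W × U` (`minMax_lt_iff`).

For the upper tail, Sion's theorem exchanges min and max in the primary problem; negation then gives
a lower tail with the two index sets swapped. The auxiliary problem need not be convex-concave, but
it only requires weak duality. The two tails together give concentration about any `μ`. For the
minimizer, if `wHat` leaves `A` then the primary value over `Sw \ A` is at most the one over `Sw`.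
The gap of `3η` makes this impossible outside two events, each of probability at most `2^M ε`; the
one concerning `Sw \ A` is a lower tail, so that set need not be convex. -/

lemma hasDerivAt_gaussianPDFReal (x : ℝ) :
    HasDerivAt (gaussianPDFReal 0 1) (-(x * gaussianPDFReal 0 1 x)) x := by
  have h : HasDerivAt (fun y : ℝ => -(y - 0) ^ 2 / (2 * ((1 : NNReal) : ℝ))) (-x) x := by
    refine ((((hasDerivAt_id' x).sub_const 0).fun_pow 2).fun_neg.div_const
      (2 * ((1 : NNReal) : ℝ))).congr_deriv ?_
    simp only [NNReal.coe_one]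
    push_cast
    ring
  rw [gaussianPDFReal_def]
  refine ((h.exp).const_mul ((√(2 * Real.pi * ((1 : NNReal) : ℝ)))⁻¹)).congr_deriv ?_
  ring

lemma integrable_mul_gaussianPDFReal :
    Integrable (fun x : ℝ => x * gaussianPDFReal 0 1 x) := by
  have h := (integrable_mul_exp_neg_mul_sq (b := 1 / 2) (by norm_num)).const_mul
    ((√(2 * Real.pi * ((1 : NNReal) : ℝ)))⁻¹)
  refine h.congr (ae_of_all _ fun x => ?_)
  simp only [gaussianPDFReal_def, NNReal.coe_one]
  rw [show -(1 / 2 : ℝ) * x ^ 2 = -(x - 0) ^ 2 / (2 * 1) by ring]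
  ring

/-- The standard normal density satisfies `φ' = -x φ`, so this is integration by parts on the line;
boundedness of `g` and `g'` supplies the integrability. -/
lemma integral_mul_gaussianReal_eq {g g' : ℝ → ℝ} (hg : ∀ x, HasDerivAt g (g' x) x) {C C' : ℝ}
    (hC : ∀ x, |g x| ≤ C) (hC' : ∀ x, |g' x| ≤ C') :
    ∫ x, x * g x ∂gaussianReal 0 1 = ∫ x, g' x ∂gaussianReal 0 1 := by
  have hgm : Measurable g := (continuous_iff_continuousAt.2 fun x => (hg x).continuousAt).measurable
  have hgm' : Measurable g' := by
    rw [show g' = deriv g from funext fun x => (hg x).deriv.symm]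
    exact measurable_deriv g
  rw [integral_gaussianReal_eq_integral_smul one_ne_zero,
    integral_gaussianReal_eq_integral_smul one_ne_zero]
  have hint : ∀ {k : ℝ → ℝ} {D : ℝ} {r : ℝ → ℝ}, Measurable k → (∀ x, |k x| ≤ D) →
      Integrable r → Integrable (fun x => k x * r x) := fun hk hD hr =>
    hr.bdd_mul hk.aestronglyMeasurable (ae_of_all _ hD)
  have h := integral_mul_deriv_eq_deriv_mul_of_integrable (u := g) (u' := g')
    (v := gaussianPDFReal 0 1) (v' := fun x => -(x * gaussianPDFReal 0 1 x))
    (fun x _ => hg x) (fun x _ => hasDerivAt_gaussianPDFReal x)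
    (hint hgm hC integrable_mul_gaussianPDFReal.neg)
    (hint hgm' hC' (integrable_gaussianPDFReal 0 1))
    (hint hgm hC (integrable_gaussianPDFReal 0 1))
  have e1 : ∀ x, gaussianPDFReal 0 1 x • (x * g x) = -(g x * -(x * gaussianPDFReal 0 1 x)) :=
    fun x => by simp only [smul_eq_mul]; ring
  have e2 : ∀ x, gaussianPDFReal 0 1 x • g' x = g' x * gaussianPDFReal 0 1 x :=
    fun x => by simp only [smul_eq_mul]; ring
  simp_rw [e1, e2]
  rw [integral_neg, h, neg_neg]

/-- Resampling one coordinate leaves a product of probability measures invariant. -/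
lemma measurePreserving_update {r : Type*} [Fintype r] [DecidableEq r] (μ : Measure ℝ)
    [IsProbabilityMeasure μ] (k : r) :
    MeasurePreserving (fun z : (r → ℝ) × ℝ => Function.update z.1 k z.2)
      ((Measure.pi fun _ => μ).prod μ) (Measure.pi fun _ => μ) := by
  have hm : Measurable (fun z : (r → ℝ) × ℝ => Function.update z.1 k z.2) := by
    refine measurable_pi_iff.2 fun i => ?_
    by_cases h : i = k
    · subst h; simpa using measurable_snd
    · simp only [Function.update_of_ne h]; fun_prop
  refine ⟨hm, (Measure.pi_eq fun s hs => ?_).symm⟩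
  rw [Measure.map_apply hm (MeasurableSet.univ_pi hs)]
  have : (fun z : (r → ℝ) × ℝ => Function.update z.1 k z.2) ⁻¹' (Set.univ.pi s) =
      -- The old `k`-th coordinate is discarded, so its factor is the whole line, of mass one.
      (Set.univ.pi (Function.update s k Set.univ)) ×ˢ (s k) := by
    ext z
    simp only [Set.mem_preimage, Set.mem_pi, Set.mem_univ, true_implies, Set.mem_prod]
    constructor
    · intro h
      refine ⟨fun i => ?_, by simpa using h k⟩
      by_cases hi : i = k
      · subst hi; simp
      · simpa [hi] using h i
    · rintro ⟨h1, h2⟩ i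
      by_cases hi : i = k
      · subst hi; simpa using h2
      · simpa [hi] using h1 i
  rw [this, Measure.prod_prod, Measure.pi_pi,
    ← Finset.mul_prod_erase Finset.univ _ (Finset.mem_univ k),
    ← Finset.mul_prod_erase Finset.univ (fun i => μ (s i)) (Finset.mem_univ k)]
  simp only [Function.update_self, measure_univ, one_mul]
  rw [mul_comm]
  congr 1
  exact Finset.prod_congr rfl fun i hi => by rw [Function.update_of_ne (Finset.ne_of_mem_erase hi)]

lemma integrable_eval_gaussian {r : Type*} [Fintype r] (k : r) :
    Integrable (fun x : r → ℝ => x k) (Measure.pi fun _ => gaussianReal 0 1) := by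
  classical
  have h := measurePreserving_eval (fun _ : r => gaussianReal 0 1) k
  exact h.integrable_comp_of_integrable (g := fun x => x) (IsGaussian.integrable_id)

/-- Resampling the `k`-th coordinate and applying Fubini reduces this to the one-dimensional
identity with the other coordinates frozen. -/
lemma integral_eval_mul_pi_gaussian {r : Type*} [Fintype r] [DecidableEq r] (k : r)
    {G G' : (r → ℝ) → ℝ} (hGm : Measurable G) (hGm' : Measurable G')
    (hG : ∀ x t, HasDerivAt (fun s => G (Function.update x k s)) (G' (Function.update x k t)) t)
    {C C' : ℝ} (hC : ∀ x, |G x| ≤ C) (hC' : ∀ x, |G' x| ≤ C') :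
    ∫ x, x k * G x ∂(Measure.pi fun _ => gaussianReal 0 1)
      = ∫ x, G' x ∂(Measure.pi fun _ => gaussianReal 0 1) := by
  have hmp := measurePreserving_update (gaussianReal 0 1) k
  have i1 : Integrable (fun x : r → ℝ => x k * G x) (Measure.pi fun _ => gaussianReal 0 1) := by
    have := (integrable_eval_gaussian k).bdd_mul (c := C) hGm.aestronglyMeasurable (ae_of_all _ hC)
    exact this.congr (ae_of_all _ fun x => mul_comm _ _)
  have i2 : Integrable G' (Measure.pi fun _ : r => gaussianReal 0 1) :=
    Integrable.of_bound hGm'.aestronglyMeasurable C' (ae_of_all _ hC')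
  rw [← hmp.map_eq]
  rw [← hmp.map_eq] at i1 i2
  rw [integral_map hmp.aemeasurable i1.aestronglyMeasurable,
    integral_map hmp.aemeasurable i2.aestronglyMeasurable,
    integral_prod (fun z : (r → ℝ) × ℝ => Function.update z.1 k z.2 k * G (Function.update z.1 k z.2))
      (i1.comp_aemeasurable hmp.aemeasurable),
    integral_prod (fun z : (r → ℝ) × ℝ => G' (Function.update z.1 k z.2))
      (i2.comp_aemeasurable hmp.aemeasurable)]
  refine integral_congr_ae (ae_of_all _ fun x => ?_)
  simp only [Function.update_self]
  exact integral_mul_gaussianReal_eq (hG x) (fun _ => hC _) (fun _ => hC' _)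

/-! ### Bounded functions of class `C²` with bounded derivatives -/

/-- `F` is of class `C²`, and `F` and its first two derivatives are bounded. -/
structure C2Bounded {E : Type*} [NormedAddCommGroup E] [NormedSpace ℝ E] (F : E → ℝ) : Prop where
  contDiff : ContDiff ℝ 2 F
  bounded : ∀ n : ℕ, n ≤ 2 → ∃ C, ∀ z, ‖iteratedFDeriv ℝ n F z‖ ≤ C

namespace C2Bounded

variable {E E' : Type*} [NormedAddCommGroup E] [NormedSpace ℝ E] [NormedAddCommGroup E']
  [NormedSpace ℝ E'] {F G : E → ℝ}

lemma const (c : ℝ) : C2Bounded (fun _ : E => c) where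
  contDiff := contDiff_const
  bounded n _ := by
    rcases n.eq_zero_or_pos with rfl | hn
    · exact ⟨|c|, fun z => by simp⟩
    · exact ⟨0, fun z => by rw [iteratedFDeriv_const_of_ne hn.ne']; simp⟩

lemma sub (hF : C2Bounded F) (hG : C2Bounded G) : C2Bounded (fun z => F z - G z) where
  contDiff := hF.contDiff.sub hG.contDiff
  bounded n hn := by
    obtain ⟨C, hC⟩ := hF.bounded n hn
    obtain ⟨D, hD⟩ := hG.bounded n hn
    refine ⟨C + D, fun z => ?_⟩
    have hn' : (n : WithTop ℕ∞) ≤ 2 := by exact_mod_cast hn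
    have : iteratedFDeriv ℝ n (fun z => F z - G z) z
        = iteratedFDeriv ℝ n F z - iteratedFDeriv ℝ n G z :=
      iteratedFDeriv_sub_apply (hF.contDiff.of_le hn').contDiffAt (hG.contDiff.of_le hn').contDiffAt
    rw [this]
    exact (norm_sub_le _ _).trans (add_le_add (hC z) (hD z))

lemma mul (hF : C2Bounded F) (hG : C2Bounded G) : C2Bounded (fun z => F z * G z) where
  contDiff := hF.contDiff.mul hG.contDiff
  bounded n hn := by
    choose! C hC using hF.bounded
    choose! D hD using hG.bounded
    refine ⟨∑ i ∈ Finset.range (n + 1), (n.choose i : ℝ) * C i * D (n - i), fun z => ?_⟩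
    refine (norm_iteratedFDeriv_mul_le hF.contDiff hG.contDiff z (by exact_mod_cast hn)).trans
      (Finset.sum_le_sum fun i hi => ?_)
    have hi' : i ≤ 2 := by have := Finset.mem_range.1 hi; omega
    have := hC i hi' z
    have := hD (n - i) (by omega) z
    have := (norm_nonneg _).trans (hC i hi' z)
    gcongr

lemma prod {ι : Type*} (s : Finset ι) {F : ι → E → ℝ} (hF : ∀ i ∈ s, C2Bounded (F i)) :
    C2Bounded (fun z => ∏ i ∈ s, F i z) := by
  classical
  induction s using Finset.induction_on with
  | empty => simpa using const 1
  | insert a s ha ih =>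
    simp_rw [Finset.prod_insert ha]
    exact (hF a (by simp)).mul (ih fun i hi => hF i (by simp [hi]))

lemma comp_clm (hF : C2Bounded F) (L : E' →L[ℝ] E) : C2Bounded (fun z => F (L z)) where
  contDiff := hF.contDiff.comp L.contDiff
  bounded n hn := by
    obtain ⟨C, hC⟩ := hF.bounded n hn
    refine ⟨C * ∏ _i : Fin n, ‖L‖, fun z => ?_⟩
    have := L.iteratedFDeriv_comp_right hF.contDiff z (i := n) (by exact_mod_cast hn)
    rw [show (fun z => F (L z)) = F ∘ L from rfl, this]
    refine (ContinuousMultilinearMap.norm_compContinuousLinearMap_le _ _).trans ?_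
    gcongr
    exact hC _

lemma exists_bound (hF : C2Bounded F) : ∃ C, 0 ≤ C ∧ (∀ z, |F z| ≤ C) ∧ (∀ z, ‖fderiv ℝ F z‖ ≤ C) ∧
    ∀ z, ‖fderiv ℝ (fderiv ℝ F) z‖ ≤ C := by
  obtain ⟨C0, h0⟩ := hF.bounded 0 (by norm_num)
  obtain ⟨C1, h1⟩ := hF.bounded 1 (by norm_num)
  obtain ⟨C2, h2⟩ := hF.bounded 2 (by norm_num)
  refine ⟨max 0 (max C0 (max C1 C2)), le_max_left _ _, fun z => ?_, fun z => ?_, fun z => ?_⟩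
  · have := h0 z
    rw [norm_iteratedFDeriv_zero] at this
    exact this.trans (by simp)
  · rw [← norm_iteratedFDeriv_one]
    exact (h1 z).trans (by simp)
  · rw [← norm_iteratedFDeriv_one, norm_iteratedFDeriv_fderiv]
    exact (h2 z).trans (by simp)

/-- An affine reparametrization of the sigmoid function is bounded with bounded derivatives. -/
lemma sigmoid_affine (a b : ℝ) : C2Bounded (fun x : ℝ => Real.sigmoid (a * x + b)) := by
  have hd : ∀ x, HasDerivAt (fun x : ℝ => Real.sigmoid (a * x + b))
      (Real.sigmoid (a * x + b) * (1 - Real.sigmoid (a * x + b)) * a) x := fun x => by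
    have h := (((hasDerivAt_id' x).const_mul a).add_const b)
    have h' := (Real.hasDerivAt_sigmoid (a * x + b)).comp x h
    rw [mul_one] at h'
    exact h'
  have hd1 : deriv (fun x : ℝ => Real.sigmoid (a * x + b)) = fun x =>
      Real.sigmoid (a * x + b) * (1 - Real.sigmoid (a * x + b)) * a := funext fun x => (hd x).deriv
  -- All derivatives are polynomials in the sigmoid itself, whose values lie in `[0, 1]`; this is
  -- the source of the bounds.
  have hd2 : deriv (deriv (fun x : ℝ => Real.sigmoid (a * x + b))) = fun x =>
      (Real.sigmoid (a * x + b) * (1 - Real.sigmoid (a * x + b)) * a)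
        * (1 - 2 * Real.sigmoid (a * x + b)) * a := by
    rw [hd1]
    funext x
    have := (((hd x).mul ((hd x).const_sub 1)).mul_const a).deriv
    refine Eq.trans ?_ (this.trans ?_)
    · rfl
    · ring
  have hs : ∀ x, |Real.sigmoid (a * x + b)| ≤ 1 := fun x => by
    rw [abs_of_nonneg (Real.sigmoid_nonneg _)]; exact Real.sigmoid_le_one _
  have hs1 : ∀ x, |1 - Real.sigmoid (a * x + b)| ≤ 1 := fun x => by
    rw [abs_le]; constructor <;> linarith [Real.sigmoid_nonneg (a * x + b),
      Real.sigmoid_le_one (a * x + b)]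
  have hs2 : ∀ x, |1 - 2 * Real.sigmoid (a * x + b)| ≤ 1 := fun x => by
    rw [abs_le]; constructor <;> linarith [Real.sigmoid_nonneg (a * x + b),
      Real.sigmoid_le_one (a * x + b)]
  refine ⟨?_, fun n hn => ?_⟩
  · exact (contDiff_sigmoid.of_le le_top).comp (by fun_prop)
  · simp_rw [norm_iteratedFDeriv_eq_norm_iteratedDeriv]
    interval_cases n
    · exact ⟨1, fun z => by simpa using hs z⟩
    · refine ⟨1 * 1 * |a|, fun z => ?_⟩
      rw [iteratedDeriv_one, hd1, Real.norm_eq_abs, abs_mul, abs_mul]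
      gcongr
      exacts [hs z, hs1 z]
    · refine ⟨1 * 1 * |a| * 1 * |a|, fun z => ?_⟩
      rw [iteratedDeriv_succ, iteratedDeriv_one, hd2, Real.norm_eq_abs]
      simp only [abs_mul _ a, abs_mul _ (1 - 2 * Real.sigmoid (a * z + b)),
        abs_mul _ (1 - Real.sigmoid (a * z + b))]
      gcongr
      exacts [hs z, hs1 z, hs2 z]

end C2Bounded

/-! ### Finite centred Gaussian families -/

lemma clm_apply_eq_sum {κ : Type*} [Fintype κ] [DecidableEq κ] (L : (κ → ℝ) →L[ℝ] ℝ) (v : κ → ℝ) :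
    L v = ∑ k, v k * L (Pi.single k 1) := by
  conv_lhs => rw [← Finset.univ_sum_single v, map_sum]
  refine Finset.sum_congr rfl fun i _ => ?_
  have : (Pi.single i (v i) : κ → ℝ) = v i • Pi.single i 1 := by
    rw [← Pi.single_smul, smul_eq_mul, mul_one]
  rw [this, map_smul, smul_eq_mul]

/-- The random vector `X` is centred Gaussian with covariance matrix `K`, in terms of its
characteristic function. -/
structure IsCenteredGaussian {Ω κ : Type*} [MeasurableSpace Ω] [Fintype κ] (P : Measure Ω)
    (X : Ω → κ → ℝ) (K : Matrix κ κ ℝ) : Prop where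
  aemeasurable : AEMeasurable X P
  charFun : ∀ c : κ → ℝ, ∫ ω, Complex.exp (((c ⬝ᵥ X ω : ℝ) : ℂ) * Complex.I) ∂P
    = Complex.exp (-((c ⬝ᵥ (K *ᵥ c) : ℝ) : ℂ) / 2)

namespace IsCenteredGaussian

variable {Ω Ω' κ : Type*} [MeasurableSpace Ω] [MeasurableSpace Ω'] [Fintype κ]
  {P : Measure Ω} {P' : Measure Ω'} {X : Ω → κ → ℝ} {Y : Ω' → κ → ℝ} {K K' : Matrix κ κ ℝ}

/-- A law on `ℝ^κ` is determined by its characteristic function. Any convenient realization of the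
covariance may therefore replace the given vector, and degenerate `K` needs no separate treatment.
-/
lemma map_eq [IsFiniteMeasure P] [IsFiniteMeasure P'] (hX : IsCenteredGaussian P X K)
    (hY : IsCenteredGaussian P' Y K) : P.map X = P'.map Y := by
  classical
  refine Measure.ext_of_charFunDual ?_
  ext L
  have hL : ∀ v, L v = (fun i => L (Pi.single i 1)) ⬝ᵥ v := fun v => by
    rw [clm_apply_eq_sum]
    exact Finset.sum_congr rfl fun i _ => mul_comm _ _
  have hc : Continuous fun v : κ → ℝ => Complex.exp ((L v : ℂ) * Complex.I) := by fun_prop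
  rw [charFunDual_apply, charFunDual_apply, integral_map hX.aemeasurable hc.aestronglyMeasurable,
    integral_map hY.aemeasurable hc.aestronglyMeasurable]
  simp only [fun ω => hL (X ω), fun ω => hL (Y ω)]
  rw [hX.charFun, hY.charFun]

lemma integral_comp_eq [IsFiniteMeasure P] [IsFiniteMeasure P'] (hX : IsCenteredGaussian P X K)
    (hY : IsCenteredGaussian P' Y K) {F : (κ → ℝ) → ℝ} (hF : Continuous F) :
    ∫ ω, F (X ω) ∂P = ∫ ω, F (Y ω) ∂P' := by
  rw [← integral_map hX.aemeasurable hF.aestronglyMeasurable, hX.map_eq hY,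
    integral_map hY.aemeasurable hF.aestronglyMeasurable]

lemma of_hasLaw {Z : Ω → Ω'} (hY : IsCenteredGaussian P' Y K) (hZ : HasLaw Z P' P) :
    IsCenteredGaussian P (fun ω => Y (Z ω)) K where
  aemeasurable := by
    have h := hY.aemeasurable
    rw [← hZ.map_eq] at h
    exact h.comp_aemeasurable hZ.aemeasurable
  charFun c := by
    rw [← hY.charFun c]
    have h := hY.aemeasurable
    rw [← hZ.map_eq] at h ⊢
    rw [integral_map hZ.aemeasurable]
    refine AEMeasurable.aestronglyMeasurable ?_
    have hc : Continuous fun v : κ → ℝ => Complex.exp (((c ⬝ᵥ v : ℝ) : ℂ) * Complex.I) := by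
      unfold dotProduct; fun_prop
    exact hc.measurable.comp_aemeasurable h

lemma prod [IsProbabilityMeasure P] [IsProbabilityMeasure P'] (hX : IsCenteredGaussian P X K)
    (hY : IsCenteredGaussian P' Y K') :
    IsCenteredGaussian (P.prod P') (fun z => X z.1 + Y z.2) (K + K') where
  aemeasurable := by
    have h1 : AEMeasurable (fun z : Ω × Ω' => X z.1) (P.prod P') := hX.aemeasurable.comp_fst
    have h2 : AEMeasurable (fun z : Ω × Ω' => Y z.2) (P.prod P') := hY.aemeasurable.comp_snd
    exact h1.add h2
  charFun c := by
    simp_rw [dotProduct_add, Complex.ofReal_add, add_mul, Complex.exp_add]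
    rw [integral_prod_mul (fun ω => Complex.exp (((c ⬝ᵥ X ω : ℝ) : ℂ) * Complex.I))
      (fun ω => Complex.exp (((c ⬝ᵥ Y ω : ℝ) : ℂ) * Complex.I)), hX.charFun, hY.charFun,
      ← Complex.exp_add, add_mulVec, dotProduct_add, Complex.ofReal_add]
    congr 1
    ring

lemma pi {ι : Type*} [Fintype ι] {Ω : ι → Type*} [∀ i, MeasurableSpace (Ω i)]
    {μ : ∀ i, Measure (Ω i)} [∀ i, IsProbabilityMeasure (μ i)] {X : ∀ i, Ω i → κ → ℝ}
    {K : ι → Matrix κ κ ℝ} (hX : ∀ i, IsCenteredGaussian (μ i) (X i) (K i)) :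
    IsCenteredGaussian (Measure.pi μ) (fun z => ∑ i, X i (z i)) (∑ i, K i) where
  aemeasurable := by
    refine Finset.aemeasurable_fun_sum _ fun i _ => ?_
    exact (hX i).aemeasurable.comp_quasiMeasurePreserving
      (measurePreserving_eval μ i).quasiMeasurePreserving
  charFun c := by
    simp_rw [dotProduct_sum, Complex.ofReal_sum, Finset.sum_mul, Complex.exp_sum]
    rw [integral_fintype_prod_eq_prod
      (fun i ω => Complex.exp (((c ⬝ᵥ X i ω : ℝ) : ℂ) * Complex.I))]
    simp_rw [(hX _).charFun, ← Complex.exp_sum, sum_mulVec, dotProduct_sum, Complex.ofReal_sum]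
    rw [← Finset.sum_div, Finset.sum_neg_distrib]

lemma gaussianReal (v : κ → ℝ) :
    IsCenteredGaussian (gaussianReal 0 1) (fun x => x • v) (vecMulVec v v) where
  aemeasurable := by fun_prop
  charFun c := by
    have h := charFun_gaussianReal (μ := 0) (v := 1) (c ⬝ᵥ v)
    rw [charFun_apply_real] at h
    have e : c ⬝ᵥ (vecMulVec v v *ᵥ c) = (c ⬝ᵥ v) ^ 2 := by
      rw [vecMulVec_mulVec, dotProduct_smul, dotProduct_comm v c]
      simp [sq]
    rw [e]
    simp only [dotProduct_smul, smul_eq_mul]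
    convert h using 2
    · funext x
      push_cast
      ring_nf
    · push_cast
      ring

lemma stdGaussian {r : Type*} [Fintype r] (A : Matrix κ r ℝ) :
    IsCenteredGaussian (Measure.pi fun _ : r => ProbabilityTheory.gaussianReal 0 1)
      (fun z => A *ᵥ z) (A * Aᵀ) := by
  have h := pi (fun i : r => gaussianReal (fun k => A k i))
  have e1 : (fun z : r → ℝ => ∑ i, z i • fun k => A k i) = fun z => A *ᵥ z := by
    funext z k
    simp [mulVec, dotProduct, mul_comm]
  have e2 : (∑ i, vecMulVec (fun k => A k i) fun k => A k i) = A * Aᵀ := by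
    ext k l
    simp [Matrix.sum_apply, vecMulVec_apply, mul_apply]
  rwa [e1, e2] at h

/-- A characteristic function has modulus at most one, so `exp (-cᵀKc / 2) ≤ 1`. Positive
semi-definiteness of `K` thus need not be assumed. -/
lemma dotProduct_nonneg [IsProbabilityMeasure P] (hX : IsCenteredGaussian P X K) (c : κ → ℝ) :
    0 ≤ c ⬝ᵥ (K *ᵥ c) := by
  have h : ‖∫ ω, Complex.exp (((c ⬝ᵥ X ω : ℝ) : ℂ) * Complex.I) ∂P‖ ≤ 1 := by
    refine (norm_integral_le_integral_norm _).trans ?_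
    simp [Complex.norm_exp_ofReal_mul_I]
  rw [hX.charFun, Complex.norm_exp] at h
  have h2 := Real.exp_le_one_iff.1 h
  have e : (-((c ⬝ᵥ (K *ᵥ c) : ℝ) : ℂ) / 2).re = -(c ⬝ᵥ (K *ᵥ c)) / 2 := by
    rw [← Complex.ofReal_neg]
    rw [show (2 : ℂ) = ((2 : ℝ) : ℂ) by norm_num, ← Complex.ofReal_div, Complex.ofReal_re]
  rw [e] at h2
  linarith

lemma exists_factor [IsProbabilityMeasure P] (hX : IsCenteredGaussian P X K) (hK : Kᵀ = K) :
    ∃ A : Matrix κ κ ℝ, A * Aᵀ = K := by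
  classical
  have hpsd : K.PosSemidef := by
    refine PosSemidef.of_dotProduct_mulVec_nonneg ?_ fun c => ?_
    · rw [IsHermitian, conjTranspose_eq_transpose_of_trivial, hK]
    · simpa using hX.dotProduct_nonneg c
  refine ⟨CFC.sqrt K, ?_⟩
  have h1 : (CFC.sqrt K)ᵀ = CFC.sqrt K := by
    have := (CFC.sqrt_nonneg K).isSelfAdjoint
    rw [isSelfAdjoint_iff, star_eq_conjTranspose, conjTranspose_eq_transpose_of_trivial] at this
    exact this
  rw [h1, CFC.sqrt_mul_sqrt_self K hpsd.nonneg]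

end IsCenteredGaussian

/-! ### Gaussian interpolation -/

section Interpolation

variable {κ r : Type*} [Fintype κ] [Fintype r] [DecidableEq κ]

/-- The partial derivative of `F` in the `k`-th coordinate. -/
def partialDeriv (F : (κ → ℝ) → ℝ) (k : κ) (z : κ → ℝ) : ℝ := fderiv ℝ F z (Pi.single k 1)

lemma fderiv_apply_eq_sum (F : (κ → ℝ) → ℝ) (z v : κ → ℝ) :
    fderiv ℝ F z v = ∑ k, v k * partialDeriv F k z :=
  clm_apply_eq_sum _ v

variable {F : (κ → ℝ) → ℝ}

lemma C2Bounded.contDiff_partialDeriv (hF : C2Bounded F) (k : κ) :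
    ContDiff ℝ 1 (partialDeriv F k) :=
  (hF.contDiff.fderiv_right (m := 1) (by norm_num)).clm_apply contDiff_const

lemma norm_single_one_le (k : κ) : ‖(Pi.single k 1 : κ → ℝ)‖ ≤ 1 := by
  rw [pi_norm_le_iff_of_nonneg zero_le_one]
  intro i
  by_cases h : i = k
  · subst h; simp
  · simp [h]

lemma C2Bounded.exists_bound_partialDeriv (hF : C2Bounded F) : ∃ C, 0 ≤ C ∧ (∀ z, |F z| ≤ C) ∧
    (∀ k z, |partialDeriv F k z| ≤ C) ∧
      ∀ k l z, |partialDeriv (partialDeriv F k) l z| ≤ C := by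
  obtain ⟨C, h0, hC, hC1, hC2⟩ := hF.exists_bound
  refine ⟨C, h0, hC, fun k z => ?_, fun k l z => ?_⟩
  · refine ((fderiv ℝ F z).le_opNorm _).trans ?_
    calc _ ≤ C * 1 := by gcongr; exacts [hC1 z, norm_single_one_le k]
      _ = C := mul_one C
  · have hd : DifferentiableAt ℝ (fderiv ℝ F) z :=
      (hF.contDiff.fderiv_right (m := 1) (by norm_num)).differentiable (by norm_num) z
    have : partialDeriv (partialDeriv F k) l z
        = fderiv ℝ (fderiv ℝ F) z (Pi.single l 1) (Pi.single k 1) := by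
      have h := (hd.hasFDerivAt.clm_apply (hasFDerivAt_const (Pi.single k (1 : ℝ)) z)).fderiv
      unfold partialDeriv
      rw [h]
      simp
    rw [this]
    refine ((fderiv ℝ (fderiv ℝ F) z (Pi.single l 1)).le_opNorm _).trans ?_
    calc _ ≤ (C * 1) * 1 := by
          gcongr
          · refine ((fderiv ℝ (fderiv ℝ F) z).le_opNorm _).trans ?_
            gcongr; exacts [hC2 z, norm_single_one_le l]
          · exact norm_single_one_le k
      _ = C := by ring

/-- Gaussian integration by parts for `G` composed with a linear map. -/
lemma integral_eval_mul_comp_mulVec {G : (κ → ℝ) → ℝ} (hG : ContDiff ℝ 1 G) {C : ℝ}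
    (hC : ∀ z, |G z| ≤ C) (hC' : ∀ l z, |partialDeriv G l z| ≤ C) (A : Matrix κ r ℝ) (i : r) :
    ∫ x, x i * G (A *ᵥ x) ∂(Measure.pi fun _ : r => gaussianReal 0 1)
      = ∑ l, A l i * ∫ x, partialDeriv G l (A *ᵥ x) ∂(Measure.pi fun _ : r => gaussianReal 0 1) := by
  classical
  have hcA : Continuous fun x : r → ℝ => A *ᵥ x := by fun_prop
  have hcp : ∀ l, Continuous (partialDeriv G l) := fun l =>
    (hG.continuous_fderiv (by norm_num)).clm_apply continuous_const
  have hint : ∀ l, Integrable (fun x : r → ℝ => partialDeriv G l (A *ᵥ x))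
      (Measure.pi fun _ : r => gaussianReal 0 1) := fun l =>
    Integrable.of_bound ((hcp l).comp hcA).aestronglyMeasurable C (ae_of_all _ fun x => hC' l _)
  rw [integral_eval_mul_pi_gaussian i (G := fun x => G (A *ᵥ x))
    (G' := fun x => ∑ l, A l i * partialDeriv G l (A *ᵥ x)) (hG.continuous.comp hcA).measurable
    (by have := hcp; fun_prop) (C := C) (C' := ∑ l, |A l i| * C) ?_ (fun x => hC _) ?_]
  · rw [integral_finsetSum _ fun l _ => (hint l).const_mul _]
    simp_rw [integral_const_mul]
  · intro x t
    have h1 : HasDerivAt (fun s : ℝ => A *ᵥ Function.update x i s) (fun l => A l i) t := by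
      have : (fun s : ℝ => A *ᵥ Function.update x i s)
          = fun s => A *ᵥ (Function.update x i 0) + s • fun l => A l i := by
        funext s l
        have : Function.update x i s = Function.update x i 0 + Pi.single i s := by
          funext j; by_cases h : j = i
          · subst h; simp
          · simp [h]
        rw [this, mulVec_add]
        simp [mulVec_single]
      rw [this]
      simpa using ((hasDerivAt_id t).smul_const (fun l => A l i)).const_add
        (A *ᵥ (Function.update x i 0))
    have h2 := ((hG.differentiable (by norm_num) (A *ᵥ Function.update x i t)).hasFDerivAt).comp_hasDerivAt
      t h1
    rw [fderiv_apply_eq_sum] at h2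
    exact h2
  · intro x
    refine (Finset.abs_sum_le_sum_abs _ _).trans (Finset.sum_le_sum fun l _ => ?_)
    rw [abs_mul]
    gcongr
    exact hC' l _

/-- The chain rule produces `∑_k (A' x)_k ∂_k F (A x)`; integrating each `x_i` by parts replaces it
by `∑_l A_{li} ∂_l`, and the coefficients assemble into `A' Aᵀ`. Bounded entries of `A'` provide one
integrable dominating function for all `θ`. -/
lemma hasDerivAt_integral_comp_mulVec (hF : C2Bounded F) {A A' : ℝ → Matrix κ r ℝ}
    (hA : ∀ θ k i, HasDerivAt (fun θ => A θ k i) (A' θ k i) θ) {D : ℝ}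
    (hD : ∀ θ k i, |A' θ k i| ≤ D) (θ : ℝ) :
    HasDerivAt (fun θ => ∫ x, F (A θ *ᵥ x) ∂(Measure.pi fun _ : r => gaussianReal 0 1))
      (∑ k, ∑ l, (A' θ * (A θ)ᵀ) k l *
        ∫ x, partialDeriv (partialDeriv F k) l (A θ *ᵥ x)
          ∂(Measure.pi fun _ : r => gaussianReal 0 1)) θ := by
  obtain ⟨C, h0, hC, hC1, hC2⟩ := hF.exists_bound_partialDeriv
  set μ := Measure.pi fun _ : r => gaussianReal 0 1
  have hcA : ∀ θ, Continuous fun x : r → ℝ => A θ *ᵥ x := fun θ => by fun_prop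
  have hcp : ∀ k, Continuous (partialDeriv F k) := fun k => (hF.contDiff_partialDeriv k).continuous
  have key := hasDerivAt_integral_of_dominated_loc_of_deriv_le (μ := μ) (s := Set.univ) (x₀ := θ)
    (F := fun θ x => F (A θ *ᵥ x))
    (F' := fun θ x => ∑ k, (A' θ *ᵥ x) k * partialDeriv F k (A θ *ᵥ x))
    (bound := fun x => ∑ _k : κ, (∑ i, D * |x i|) * C) Filter.univ_mem
    (Filter.Eventually.of_forall fun θ =>
      (hF.contDiff.continuous.comp (hcA θ)).aestronglyMeasurable)
    (Integrable.of_bound (hF.contDiff.continuous.comp (hcA θ)).aestronglyMeasurable C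
      (ae_of_all _ fun x => hC _))
    (Continuous.aestronglyMeasurable (by have := hcp; have := hcA; fun_prop)) ?_ ?_ ?_
  · have h := key.2
    have e : ∫ x, ∑ k, (A' θ *ᵥ x) k * partialDeriv F k (A θ *ᵥ x) ∂μ
        = ∑ k, ∑ l, (A' θ * (A θ)ᵀ) k l *
          ∫ x, partialDeriv (partialDeriv F k) l (A θ *ᵥ x) ∂μ := by
      have hi : ∀ k i, Integrable (fun x : r → ℝ => x i * partialDeriv F k (A θ *ᵥ x)) μ :=
        fun k i => by
        have := (integrable_eval_gaussian i).bdd_mul (c := C)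
          ((hcp k).comp (hcA θ)).aestronglyMeasurable (ae_of_all _ fun x => hC1 k _)
        exact this.congr (ae_of_all _ fun x => mul_comm _ _)
      obtain ⟨a, ha⟩ : ∃ a : κ → r → ℝ, ∀ k i, A' θ k i = a k i := ⟨_, fun _ _ => rfl⟩
      have e1 : ∀ x : r → ℝ, ∑ k, (A' θ *ᵥ x) k * partialDeriv F k (A θ *ᵥ x)
          = ∑ k, ∑ i, a k i * (x i * partialDeriv F k (A θ *ᵥ x)) := fun x => by
        refine Finset.sum_congr rfl fun k _ => ?_
        rw [show (A' θ *ᵥ x) k = ∑ i, A' θ k i * x i from rfl, Finset.sum_mul]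
        exact Finset.sum_congr rfl fun i _ => by rw [ha]; ring
      simp_rw [e1]
      rw [integral_finsetSum _ fun k _ => integrable_finsetSum _ fun i _ => (hi k i).const_mul _]
      refine Finset.sum_congr rfl fun k _ => ?_
      rw [integral_finsetSum _ fun i _ => (hi k i).const_mul _]
      simp_rw [integral_const_mul]
      simp_rw [show ∀ i, ∫ x, x i * partialDeriv F k (A θ *ᵥ x) ∂μ = _ from fun i =>
        integral_eval_mul_comp_mulVec (hF.contDiff_partialDeriv k) (hC1 k) (hC2 k) (A θ) i]
      simp_rw [Finset.mul_sum]
      rw [Finset.sum_comm]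
      refine Finset.sum_congr rfl fun l _ => ?_
      rw [mul_apply, Finset.sum_mul]
      exact Finset.sum_congr rfl fun i _ => by rw [transpose_apply, ha]; ring
    rwa [e] at h
  · refine ae_of_all _ fun x θ _ => ?_
    rw [Real.norm_eq_abs]
    refine (Finset.abs_sum_le_sum_abs _ _).trans (Finset.sum_le_sum fun k _ => ?_)
    rw [abs_mul]
    refine mul_le_mul ?_ (hC1 k _) (abs_nonneg _)
      (Finset.sum_nonneg fun i _ => mul_nonneg ((abs_nonneg _).trans (hD θ k i)) (abs_nonneg _))
    · rw [show (A' θ *ᵥ x) k = ∑ i, A' θ k i * x i from rfl]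
      refine (Finset.abs_sum_le_sum_abs _ _).trans (Finset.sum_le_sum fun i _ => ?_)
      rw [abs_mul]
      gcongr
      exact hD θ k i
  · refine integrable_finsetSum _ fun k _ => Integrable.mul_const ?_ _
    exact integrable_finsetSum _ fun i _ => (integrable_eval_gaussian i).abs.const_mul _
  · refine ae_of_all _ fun x θ _ => ?_
    have h1 : HasDerivAt (fun θ => A θ *ᵥ x) (A' θ *ᵥ x) θ := by
      rw [hasDerivAt_pi]
      intro k
      simp only [mulVec, dotProduct]
      exact HasDerivAt.fun_sum fun i _ => (hA θ k i).mul_const _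
    have h2 := ((hF.contDiff.differentiable (by norm_num) (A θ *ᵥ x)).hasFDerivAt).comp_hasDerivAt θ h1
    rw [fderiv_apply_eq_sum] at h2
    exact h2

/-- **Gaussian comparison**: if `F` has second partial derivatives whose signs match those of the
differences of covariances, then `E F(Y) ≤ E F(X)`. -/
theorem integral_le_integral_of_partialDeriv {Ω Ω' : Type*} [MeasurableSpace Ω]
    [MeasurableSpace Ω'] {P : Measure Ω} {P' : Measure Ω'} [IsProbabilityMeasure P]
    [IsProbabilityMeasure P'] {X : Ω → κ → ℝ} {Y : Ω' → κ → ℝ} {K K' : Matrix κ κ ℝ}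
    (hX : IsCenteredGaussian P X K) (hY : IsCenteredGaussian P' Y K') (hK : Kᵀ = K)
    (hK' : K'ᵀ = K') (hF : C2Bounded F)
    (hsign : ∀ k l z, 0 ≤ (K k l - K' k l) * partialDeriv (partialDeriv F k) l z) :
    ∫ ω, F (Y ω) ∂P' ≤ ∫ ω, F (X ω) ∂P := by
  obtain ⟨A, hA⟩ := hX.exists_factor hK
  obtain ⟨B, hB⟩ := hY.exists_factor hK'
  -- `R θ` applied to a standard Gaussian vector is `cos θ · Y + sin θ · X` with independent `X` and
  -- `Y`. The trigonometric path keeps the derivative bounded up to both endpoints, unlike `√t`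
  -- weights.
  let R : ℝ → Matrix κ (κ ⊕ κ) ℝ := fun θ => fromCols (Real.cos θ • B) (Real.sin θ • A)
  let R' : ℝ → Matrix κ (κ ⊕ κ) ℝ := fun θ => fromCols (-Real.sin θ • B) (Real.cos θ • A)
  have hR : ∀ θ k i, HasDerivAt (fun θ => R θ k i) (R' θ k i) θ := by
    rintro θ k (i | i)
    · simpa [R, R'] using (Real.hasDerivAt_cos θ).mul_const (B k i)
    · simpa [R, R'] using (Real.hasDerivAt_sin θ).mul_const (A k i)
  have hD : ∀ θ k i, |R' θ k i| ≤ ∑ k, ∑ i, (|A k i| + |B k i|) := by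
    intro θ k i
    have hle : ∀ i, |A k i| + |B k i| ≤ ∑ k, ∑ i, (|A k i| + |B k i|) := fun i =>
      (Finset.single_le_sum (f := fun i => |A k i| + |B k i|) (fun _ _ => by positivity)
        (Finset.mem_univ i)).trans
        (Finset.single_le_sum (f := fun k => ∑ i, (|A k i| + |B k i|))
          (fun _ _ => Finset.sum_nonneg fun _ _ => by positivity) (Finset.mem_univ k))
    rcases i with i | i
    · refine le_trans ?_ (hle i)
      have := mul_le_mul_of_nonneg_right (Real.abs_sin_le_one θ) (abs_nonneg (B k i))
      simp only [R', fromCols_apply_inl, Matrix.smul_apply, smul_eq_mul, abs_mul, abs_neg]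
      linarith [abs_nonneg (A k i)]
    · refine le_trans ?_ (hle i)
      have := mul_le_mul_of_nonneg_right (Real.abs_cos_le_one θ) (abs_nonneg (A k i))
      simp only [R', fromCols_apply_inr, Matrix.smul_apply, smul_eq_mul, abs_mul]
      linarith [abs_nonneg (B k i)]
  -- The blocks `A` and `B` act on disjoint coordinates, so no cross terms appear.
  have hRR : ∀ θ, R' θ * (R θ)ᵀ = (Real.sin θ * Real.cos θ) • (K - K') := by
    intro θ
    simp only [R, R', transpose_fromCols, fromCols_mul_fromRows, transpose_smul, Matrix.smul_mul,
      Matrix.mul_smul, smul_smul, hA, hB, smul_sub, neg_mul, neg_smul]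
    rw [mul_comm (Real.cos θ) (Real.sin θ)]
    abel
  set μ := Measure.pi fun _ : κ ⊕ κ => gaussianReal 0 1 with hμ
  have hder := fun θ => hasDerivAt_integral_comp_mulVec hF hR hD θ
  have hmono : MonotoneOn (fun θ => ∫ x, F (R θ *ᵥ x) ∂μ) (Set.Icc 0 (Real.pi / 2)) := by
    refine monotoneOn_of_deriv_nonneg (convex_Icc _ _)
      (fun θ _ => (hder θ).continuousAt.continuousWithinAt)
      (fun θ _ => (hder θ).differentiableAt.differentiableWithinAt) fun θ hθ => ?_
    rw [interior_Icc] at hθ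
    rw [(hder θ).deriv, hRR]
    refine Finset.sum_nonneg fun k _ => Finset.sum_nonneg fun l _ => ?_
    have hs := Real.sin_nonneg_of_mem_Icc (x := θ) ⟨hθ.1.le, by linarith [hθ.2, Real.pi_pos]⟩
    have hc := Real.cos_nonneg_of_mem_Icc (x := θ) ⟨by linarith [hθ.1, Real.pi_pos], hθ.2.le⟩
    rw [Matrix.smul_apply, smul_eq_mul, mul_assoc, ← integral_const_mul]
    exact mul_nonneg (mul_nonneg hs hc) (integral_nonneg fun x => hsign k l _)
  have hle := hmono (Set.left_mem_Icc.2 (by positivity)) (Set.right_mem_Icc.2 (by positivity))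
    (by positivity : (0 : ℝ) ≤ Real.pi / 2)
  have e0 : R 0 * (R 0)ᵀ = K' := by
    simp [R, transpose_fromCols, fromCols_mul_fromRows, hB]
  have e1 : R (Real.pi / 2) * (R (Real.pi / 2))ᵀ = K := by
    simp [R, transpose_fromCols, fromCols_mul_fromRows, hA]
  have hY' : ∫ x, F (R 0 *ᵥ x) ∂μ = ∫ ω, F (Y ω) ∂P' := (hY.integral_comp_eq (e0 ▸ IsCenteredGaussian.stdGaussian (R 0)) hF.contDiff.continuous).symm
  have hX' : ∫ x, F (R (Real.pi / 2) *ᵥ x) ∂μ = ∫ ω, F (X ω) ∂P := (hX.integral_comp_eq (e1 ▸ IsCenteredGaussian.stdGaussian (R (Real.pi / 2)))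
      hF.contDiff.continuous).symm
  rw [← hY', ← hX']
  exact hle

end Interpolation

/-! ### Gordon's comparison inequality -/

section Gordon

open Filter Topology

variable {α β : Type*} [Fintype α] [Fintype β]

/-- A smooth surrogate of the indicator function of `∀ a, ∃ b, λ_{ab} < z_{ab}`, when `h_{ab}` is a
smooth surrogate of the indicator function of `(-∞, λ_{ab}]`. -/
def gordonFun (h : α × β → ℝ → ℝ) (z : α × β → ℝ) : ℝ :=
  ∏ a, (1 - ∏ b, h (a, b) (z (a, b)))

lemma c2Bounded_gordonFun {h : α × β → ℝ → ℝ} (hh : ∀ k, C2Bounded (h k)) :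
    C2Bounded (gordonFun h) :=
  C2Bounded.prod _ fun a _ => (C2Bounded.const 1).sub <| C2Bounded.prod _ fun b _ =>
    (hh (a, b)).comp_clm (ContinuousLinearMap.proj (R := ℝ) (φ := fun _ : α × β => ℝ) (a, b))

lemma hasDerivAt_comp_update {κ : Type*} [Fintype κ] [DecidableEq κ] {G : (κ → ℝ) → ℝ}
    (hG : Differentiable ℝ G) (z : κ → ℝ) (k : κ) (t : ℝ) :
    HasDerivAt (fun s => G (Function.update z k s)) (partialDeriv G k (Function.update z k t)) t :=
  (hG (Function.update z k t)).hasFDerivAt.comp_hasDerivAt t (hasDerivAt_update z k t)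

/-- Smooth approximations, converging pointwise, of the indicator function of `(-∞, c]`. -/
def smoothIic (c : ℝ) (N : ℕ) (x : ℝ) : ℝ := Real.sigmoid (-(N : ℝ) ^ 2 * x + ((N : ℝ) ^ 2 * c + N))

lemma tendsto_smoothIic (c x : ℝ) :
    Tendsto (fun N : ℕ => smoothIic c N x) atTop (𝓝 (if x ≤ c then 1 else 0)) := by
  have hN : Tendsto (fun N : ℕ => (N : ℝ)) atTop atTop := tendsto_natCast_atTop_atTop
  -- The shift by `N` makes the limit equal to `1` at the endpoint `x = c`, while for `x > c` the
  -- slope `N ^ 2` overwhelms it.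
  have e : ∀ N : ℕ, -(N : ℝ) ^ 2 * x + ((N : ℝ) ^ 2 * c + N) = (N : ℝ) * (N * (c - x) + 1) :=
    fun N => by ring
  simp only [smoothIic, e]
  split_ifs with hx
  · refine Real.tendsto_sigmoid_atTop.comp (tendsto_atTop_mono (fun N => ?_) hN)
    have : 0 ≤ (N : ℝ) * (c - x) := mul_nonneg (Nat.cast_nonneg N) (sub_nonneg.2 hx)
    nlinarith [Nat.cast_nonneg (α := ℝ) N]
  · refine Real.tendsto_sigmoid_atBot.comp (hN.atTop_mul_atBot₀ ?_)
    exact tendsto_atBot_add_const_right _ _ (hN.atTop_mul_const_of_neg (by linarith))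

lemma tendsto_gordonFun (c z : α × β → ℝ) :
    Tendsto (fun N : ℕ => gordonFun (fun k => smoothIic (c k) N) z) atTop
      (𝓝 ({z : α × β → ℝ | ∀ a, ∃ b, c (a, b) < z (a, b)}.indicator (fun _ => 1) z)) := by
  classical
  have h : Tendsto (fun N : ℕ => gordonFun (fun k => smoothIic (c k) N) z) atTop
      (𝓝 (∏ a, (1 - ∏ b, if z (a, b) ≤ c (a, b) then 1 else 0))) :=
    tendsto_finsetProd _ fun a _ => tendsto_const_nhds.sub <|
      tendsto_finsetProd _ fun b _ => tendsto_smoothIic _ _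
  convert h using 2
  have e : ∀ a, (1 - ∏ b, if z (a, b) ≤ c (a, b) then (1 : ℝ) else 0)
      = if ∃ b, c (a, b) < z (a, b) then 1 else 0 := fun a => by
    rw [Finset.prod_boole]
    by_cases h : ∃ b, c (a, b) < z (a, b)
    · rw [if_pos h, if_neg]
      · simp
      · obtain ⟨b, hb⟩ := h
        exact fun h' => absurd (h' b (Finset.mem_univ b)) (not_le.2 hb)
    · rw [if_neg h, if_pos]
      · simp
      · push Not at h
        exact fun b _ => h b
  simp_rw [e]
  rw [Finset.prod_boole]
  simp [Set.indicator_apply]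

variable [DecidableEq α] [DecidableEq β]

/-- Only the factor of row `a` contains `z (a, b)`, and it is affine in `h (a, b)`. -/
lemma partialDeriv_gordonFun {h : α × β → ℝ → ℝ} (hh : ∀ k, C2Bounded (h k)) (a : α) (b : β)
    (z : α × β → ℝ) :
    partialDeriv (gordonFun h) (a, b) z =
      -(deriv (h (a, b)) (z (a, b)) * ∏ b' ∈ Finset.univ.erase b, h (a, b') (z (a, b')))
        * ∏ a' ∈ Finset.univ.erase a, (1 - ∏ b', h (a', b') (z (a', b'))) := by
  have h1 := hasDerivAt_comp_update
    ((c2Bounded_gordonFun hh).contDiff.differentiable (by norm_num)) z (a, b) (z (a, b))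
  rw [Function.update_eq_self] at h1
  have e : (fun s => gordonFun h (Function.update z (a, b) s)) = fun s =>
      (1 - h (a, b) s * ∏ b' ∈ Finset.univ.erase b, h (a, b') (z (a, b')))
        * ∏ a' ∈ Finset.univ.erase a, (1 - ∏ b', h (a', b') (z (a', b'))) := by
    funext s
    rw [gordonFun, ← Finset.mul_prod_erase Finset.univ _ (Finset.mem_univ a),
      ← Finset.mul_prod_erase Finset.univ _ (Finset.mem_univ b), Function.update_self]
    congr 1
    · congr 2
      refine Finset.prod_congr rfl fun b' hb' => ?_
      rw [Function.update_of_ne]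
      simp [Finset.ne_of_mem_erase hb']
    · refine Finset.prod_congr rfl fun a' ha' => ?_
      congr 1
      refine Finset.prod_congr rfl fun b' _ => ?_
      rw [Function.update_of_ne]
      simp [Finset.ne_of_mem_erase ha']
  rw [e] at h1
  have hd : HasDerivAt (h (a, b)) (deriv (h (a, b)) (z (a, b))) (z (a, b)) :=
    ((hh (a, b)).contDiff.differentiable (by norm_num) _).hasDerivAt
  exact h1.unique (((hd.mul_const _).const_sub 1).mul_const _)

lemma partialDeriv_partialDeriv_gordonFun_nonneg {h : α × β → ℝ → ℝ} (hh : ∀ k, C2Bounded (h k))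
    (hanti : ∀ k, Antitone (h k)) (h0 : ∀ k x, 0 ≤ h k x) (h1 : ∀ k x, h k x ≤ 1) {k l : α × β}
    (hkl : k.1 ≠ l.1) (z : α × β → ℝ) :
    0 ≤ partialDeriv (partialDeriv (gordonFun h) k) l z := by
  obtain ⟨a, b⟩ := k
  have hd := hasDerivAt_comp_update
    (((c2Bounded_gordonFun hh).contDiff_partialDeriv (a, b)).differentiable (by norm_num)) z l (z l)
  rw [Function.update_eq_self] at hd
  rw [← hd.deriv]
  -- It suffices that the first partial derivative is monotone in `z l`. Its row-`a` part is
  -- nonnegative, since `h` decreases, and does not involve `l`; every other row factor is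
  -- nonnegative and increases with its entries.
  refine Monotone.deriv_nonneg fun s t hst => ?_
  have hne : ∀ b', (a, b') ≠ l := fun b' hb' => hkl (by rw [← hb'])
  simp only [partialDeriv_gordonFun hh, Function.update_of_ne (hne _)]
  have hneg : 0 ≤ -(deriv (h (a, b)) (z (a, b)) *
      ∏ b' ∈ Finset.univ.erase b, h (a, b') (z (a, b'))) := by
    rw [← neg_mul]
    exact mul_nonneg (neg_nonneg.2 (hanti _).deriv_nonpos) (Finset.prod_nonneg fun _ _ => h0 _ _)
  refine mul_le_mul_of_nonneg_left (Finset.prod_le_prod (fun a' _ => ?_) fun a' _ => ?_) hneg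
  · exact sub_nonneg.2 (Finset.prod_le_one (fun _ _ => h0 _ _) fun _ _ => h1 _ _)
  · refine sub_le_sub_left (Finset.prod_le_prod (fun _ _ => h0 _ _) fun b' _ => hanti _ ?_) _
    by_cases e : (a', b') = l
    · subst e; simpa using hst
    · simp [Function.update_of_ne e]

/-- **Gordon's inequality** for finite families. -/
theorem gordon_finite {Ω Ω' : Type*} [MeasurableSpace Ω]
    [MeasurableSpace Ω'] {P : Measure Ω} {P' : Measure Ω'} [IsProbabilityMeasure P]
    [IsProbabilityMeasure P'] {X : Ω → α × β → ℝ} {Y : Ω' → α × β → ℝ}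
    {K K' : Matrix (α × β) (α × β) ℝ}
    (hX : IsCenteredGaussian P X K) (hY : IsCenteredGaussian P' Y K') (hK : Kᵀ = K)
    (hK' : K'ᵀ = K') (hle : ∀ k l, K' k l ≤ K k l) (heq : ∀ k l, k.1 = l.1 → K k l = K' k l)
    (c : α × β → ℝ) :
    P.real {ω | ∃ a, ∀ b, X ω (a, b) ≤ c (a, b)} ≤ P'.real {ω | ∃ a, ∀ b, Y ω (a, b) ≤ c (a, b)} := by
  set A : Set (α × β → ℝ) := {z | ∀ a, ∃ b, c (a, b) < z (a, b)} with hA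
  have hAm : MeasurableSet A := by
    have : A = ⋂ a, ⋃ b, {z | c (a, b) < z (a, b)} := by ext z; simp [hA]
    rw [this]
    exact MeasurableSet.iInter fun a => MeasurableSet.iUnion fun b =>
      measurableSet_lt measurable_const (measurable_pi_apply _)
  have hC : ∀ N : ℕ, ∀ k, C2Bounded (smoothIic (c k) N) := fun N k => C2Bounded.sigmoid_affine _ _
  have h0 : ∀ (N : ℕ) (k : α × β) x, 0 ≤ smoothIic (c k) N x := fun _ _ _ => Real.sigmoid_nonneg _
  have h1 : ∀ (N : ℕ) (k : α × β) x, smoothIic (c k) N x ≤ 1 := fun _ _ _ => Real.sigmoid_le_one _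
  have hanti : ∀ (N : ℕ) (k : α × β), Antitone (smoothIic (c k) N) := fun N k x y hxy => by
    refine Real.sigmoid_monotone ?_
    have : (N : ℝ) ^ 2 * x ≤ (N : ℝ) ^ 2 * y := mul_le_mul_of_nonneg_left hxy (by positivity)
    linarith
  have hcmp : ∀ N : ℕ, ∫ ω, gordonFun (fun k => smoothIic (c k) N) (Y ω) ∂P'
      ≤ ∫ ω, gordonFun (fun k => smoothIic (c k) N) (X ω) ∂P := fun N => by
    refine integral_le_integral_of_partialDeriv hX hY hK hK' (c2Bounded_gordonFun (hC N))
      fun k l z => ?_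
    by_cases hkl : k.1 = l.1
    · rw [heq k l hkl, sub_self, zero_mul]
    · exact mul_nonneg (sub_nonneg.2 (hle k l)) (partialDeriv_partialDeriv_gordonFun_nonneg
        (hC N) (hanti N) (h0 N) (h1 N) hkl z)
  have hlim : ∀ (μ : Measure (α × β → ℝ)) [IsProbabilityMeasure μ],
      Tendsto (fun N : ℕ => ∫ z, gordonFun (fun k => smoothIic (c k) N) z ∂μ) atTop
        (𝓝 (μ.real A)) := by
    intro μ _
    have e : μ.real A = ∫ z, A.indicator (fun _ => (1 : ℝ)) z ∂μ := by
      rw [integral_indicator hAm]; simp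
    rw [e]
    refine tendsto_integral_of_dominated_convergence (fun _ => 1)
      (fun N => (c2Bounded_gordonFun (hC N)).contDiff.continuous.aestronglyMeasurable)
      (integrable_const _) (fun N => ae_of_all _ fun z => ?_)
      (ae_of_all _ fun z => tendsto_gordonFun c z)
    have hp : ∀ a, 0 ≤ ∏ b, smoothIic (c (a, b)) N (z (a, b)) ∧
        ∏ b, smoothIic (c (a, b)) N (z (a, b)) ≤ 1 := fun a =>
      ⟨Finset.prod_nonneg fun _ _ => h0 _ _ _,
        Finset.prod_le_one (fun _ _ => h0 _ _ _) fun _ _ => h1 _ _ _⟩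
    rw [Real.norm_eq_abs, gordonFun, abs_of_nonneg]
    · exact Finset.prod_le_one (fun a _ => sub_nonneg.2 (hp a).2) fun a _ => by linarith [(hp a).1]
    · exact Finset.prod_nonneg fun a _ => sub_nonneg.2 (hp a).2
  have hmap : ∀ N : ℕ, ∫ z, gordonFun (fun k => smoothIic (c k) N) z ∂(P'.map Y)
      ≤ ∫ z, gordonFun (fun k => smoothIic (c k) N) z ∂(P.map X) := fun N => by
    have hm := (c2Bounded_gordonFun (hC N)).contDiff.continuous
    rw [integral_map hX.aemeasurable hm.aestronglyMeasurable,
      integral_map hY.aemeasurable hm.aestronglyMeasurable]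
    exact hcmp N
  have hX' := Measure.isProbabilityMeasure_map hX.aemeasurable
  have hY' := Measure.isProbabilityMeasure_map hY.aemeasurable
  have hfin := le_of_tendsto_of_tendsto' (hlim _) (hlim _) hmap
  -- The smooth comparison concerns `∀ a, ∃ b, c < z`; passing to complements reverses it.
  have hcompl : (P.map X).real Aᶜ ≤ (P'.map Y).real Aᶜ := by
    rw [measureReal_compl hAm, measureReal_compl hAm]
    simp only [probReal_univ]
    linarith
  rw [map_measureReal_apply_of_aemeasurable hX.aemeasurable hAm.compl,
    map_measureReal_apply_of_aemeasurable hY.aemeasurable hAm.compl] at hcompl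
  have e : Aᶜ = {z | ∃ a, ∀ b, z (a, b) ≤ c (a, b)} := by
    ext z
    simp [hA]
  rw [e] at hcompl
  exact hcompl

end Gordon

open Filter Topology

/-! ### Gaussian processes on a product index set -/

/-- `X` is a centred Gaussian process with covariance function `K`. -/
def IsCenteredGaussianProcess {Ω ι : Type*} [MeasurableSpace Ω] (P : Measure Ω)
    (X : Ω → ι → ℝ) (K : ι → ι → ℝ) : Prop :=
  ∀ (κ : Type) [Fintype κ] (e : κ → ι),
    IsCenteredGaussian P (fun ω k => X ω (e k)) (Matrix.of fun k l => K (e k) (e l))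

lemma IsCenteredGaussianProcess.aemeasurable {Ω ι : Type*} [MeasurableSpace Ω] {P : Measure Ω}
    {X : Ω → ι → ℝ} {K : ι → ι → ℝ} (hX : IsCenteredGaussianProcess P X K) (i : ι) :
    AEMeasurable (fun ω => X ω i) P :=
  (measurable_pi_apply ()).comp_aemeasurable (hX Unit fun _ => i).aemeasurable

lemma IsCenteredGaussianProcess.comp {Ω ι ι' : Type*} [MeasurableSpace Ω] {P : Measure Ω}
    {X : Ω → ι → ℝ} {K : ι → ι → ℝ} (hX : IsCenteredGaussianProcess P X K) (φ : ι' → ι) :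
    IsCenteredGaussianProcess P (fun ω i => X ω (φ i)) (fun i j => K (φ i) (φ j)) :=
  fun κ _ e => hX κ fun k => φ (e k)

lemma IsCenteredGaussianProcess.neg {Ω ι : Type*} [MeasurableSpace Ω] {P : Measure Ω}
    {X : Ω → ι → ℝ} {K : ι → ι → ℝ} (hX : IsCenteredGaussianProcess P X K) :
    IsCenteredGaussianProcess P (fun ω i => -X ω i) K := fun κ _ e => by
  refine ⟨(hX κ e).aemeasurable.neg, fun c => ?_⟩
  have h := (hX κ e).charFun (-c)
  rw [neg_dotProduct, mulVec_neg, dotProduct_neg, neg_neg] at h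
  rw [← h]
  refine integral_congr_ae (ae_of_all _ fun ω => ?_)
  simp [dotProduct]

lemma IsCenteredGaussianProcess.congr {Ω ι : Type*} [MeasurableSpace Ω] {P : Measure Ω}
    {X : Ω → ι → ℝ} {K K' : ι → ι → ℝ} (hX : IsCenteredGaussianProcess P X K)
    (h : ∀ i j, K i j = K' i j) : IsCenteredGaussianProcess P X K' := by
  rwa [show K' = K from funext fun i => funext fun j => (h i j).symm]

lemma IsCenteredGaussianProcess.prod {Ω Ω' ι : Type*} [MeasurableSpace Ω] [MeasurableSpace Ω']
    {P : Measure Ω} {P' : Measure Ω'} [IsProbabilityMeasure P] [IsProbabilityMeasure P']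
    {X : Ω → ι → ℝ} {Y : Ω' → ι → ℝ} {K K' : ι → ι → ℝ} (hX : IsCenteredGaussianProcess P X K)
    (hY : IsCenteredGaussianProcess P' Y K') :
    IsCenteredGaussianProcess (P.prod P') (fun z i => X z.1 i + Y z.2 i)
      (fun i j => K i j + K' i j) :=
  fun κ _ e => (hX κ e).prod (hY κ e)

lemma IsCenteredGaussianProcess.pi {ι : Type*} {r : Type*} [Fintype r] {Ω : r → Type*}
    [∀ i, MeasurableSpace (Ω i)] {μ : ∀ i, Measure (Ω i)} [∀ i, IsProbabilityMeasure (μ i)]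
    {X : ∀ i, Ω i → ι → ℝ} {K : r → ι → ι → ℝ}
    (hX : ∀ i, IsCenteredGaussianProcess (μ i) (X i) (K i)) :
    IsCenteredGaussianProcess (Measure.pi μ) (fun z k => ∑ i, X i (z i) k)
      (fun k l => ∑ i, K i k l) := fun κ _ e => by
  convert IsCenteredGaussian.pi fun i => hX i κ e using 1
  · funext z k
    simp
  · ext k l
    simp [Matrix.sum_apply]

lemma IsCenteredGaussianProcess.stdGaussianVec {ι : Type*} {d : ℕ} (v : ι → Fin d → ℝ) :
    IsCenteredGaussianProcess (stdGaussianVec d) (fun z i => v i ⬝ᵥ z) (fun i j => v i ⬝ᵥ v j) :=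
  fun κ _ e => by
  have h := IsCenteredGaussian.stdGaussian (Matrix.of fun k => v (e k))
  convert h using 1 <;> rfl

lemma IsCenteredGaussianProcess.gaussianReal {ι : Type*} (v : ι → ℝ) :
    IsCenteredGaussianProcess (gaussianReal 0 1) (fun z i => z * v i) (fun i j => v i * v j) :=
  fun κ _ e => by
  have h := IsCenteredGaussian.gaussianReal (fun k => v (e k))
  convert h using 1 <;> rfl

lemma IsCenteredGaussianProcess.of_hasLaw {Ω Ω' ι : Type*} [MeasurableSpace Ω]
    [MeasurableSpace Ω'] {P : Measure Ω} {P' : Measure Ω'} {Y : Ω' → ι → ℝ} {K : ι → ι → ℝ}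
    (hY : IsCenteredGaussianProcess P' Y K) {Z : Ω → Ω'} (hZ : HasLaw Z P' P) :
    IsCenteredGaussianProcess P (fun ω => Y (Z ω)) K :=
  fun κ _ e => (hY κ e).of_hasLaw hZ

/-- **Gordon's inequality** for countable families. -/
theorem gordon_countable {Ω Ω' : Type*} [MeasurableSpace Ω] [MeasurableSpace Ω']
    {P : Measure Ω} {P' : Measure Ω'} [IsProbabilityMeasure P] [IsProbabilityMeasure P']
    {X : Ω → ℕ × ℕ → ℝ} {Y : Ω' → ℕ × ℕ → ℝ} {K K' : ℕ × ℕ → ℕ × ℕ → ℝ}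
    (hX : IsCenteredGaussianProcess P X K) (hY : IsCenteredGaussianProcess P' Y K')
    (hK : ∀ k l, K k l = K l k) (hK' : ∀ k l, K' k l = K' l k)
    (hle : ∀ k l, K' k l ≤ K k l) (heq : ∀ k l, k.1 = l.1 → K k l = K' k l) (c : ℕ × ℕ → ℝ) :
    P {ω | ∃ a, ∀ b, X ω (a, b) ≤ c (a, b)} ≤ P' {ω | ∃ a, ∀ b, Y ω (a, b) ≤ c (a, b)} := by
  have hfin : ∀ m k : ℕ, P {ω | ∃ a < m, ∀ b < k, X ω (a, b) ≤ c (a, b)}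
      ≤ P' {ω | ∃ a < m, ∀ b < k, Y ω (a, b) ≤ c (a, b)} := by
    intro m k
    let e : Fin m × Fin k → ℕ × ℕ := fun q => (q.1, q.2)
    have h := gordon_finite (hX _ e) (hY _ e) (by ext q q'; exact hK _ _)
      (by ext q q'; exact hK' _ _) (fun q q' => hle _ _)
      (fun q q' hqq => heq _ _ (by simp only [e, hqq])) (fun q => c (e q))
    have h2 := (ENNReal.toReal_le_toReal (measure_ne_top P _) (measure_ne_top P' _)).1 h
    simpa only [e, Fin.exists_iff, Fin.forall_iff, exists_prop] using h2
  have hmk : ∀ m, P {ω | ∃ a < m, ∀ b, X ω (a, b) ≤ c (a, b)}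
      ≤ P' {ω | ∃ a < m, ∀ b, Y ω (a, b) ≤ c (a, b)} := by
    intro m
    have hset : {ω | ∃ a < m, ∀ b, Y ω (a, b) ≤ c (a, b)}
        = ⋂ k : ℕ, {ω | ∃ a < m, ∀ b < k, Y ω (a, b) ≤ c (a, b)} := by
      ext ω
      simp only [Set.mem_ofPred_eq, Set.mem_iInter]
      refine ⟨fun ⟨a, ha, h⟩ k => ⟨a, ha, fun b _ => h b⟩, fun h => ?_⟩
      by_contra! hcon
      -- If every row `a < m` fails at some column `b a`, a cutoff beyond all these finitely many
      -- columns contradicts the finite statement.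
      choose! b hb using hcon
      obtain ⟨a, ha, h'⟩ := h ((Finset.range m).sup b + 1)
      exact absurd (h' (b a) (Nat.lt_succ_of_le (Finset.le_sup (Finset.mem_range.2 ha))))
        (not_le.2 (hb a ha))
    have hnull : ∀ k : ℕ,
        NullMeasurableSet {ω | ∃ a < m, ∀ b < k, Y ω (a, b) ≤ c (a, b)} P' := by
      intro k
      have : {ω | ∃ a < m, ∀ b < k, Y ω (a, b) ≤ c (a, b)}
          = ⋃ a, ⋃ (_ : a < m), ⋂ b, ⋂ (_ : b < k), {ω | Y ω (a, b) ≤ c (a, b)} := by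
        ext ω; simp
      rw [this]
      exact .iUnion fun a => .iUnion fun _ => .iInter fun b => .iInter fun _ =>
        nullMeasurableSet_le (hY.aemeasurable _) aemeasurable_const
    have hanti : Antitone fun k : ℕ => {ω | ∃ a < m, ∀ b < k, Y ω (a, b) ≤ c (a, b)} :=
      fun k k' hk ω ⟨a, ha, h⟩ => ⟨a, ha, fun b hb => h b (hb.trans_le hk)⟩
    rw [hset]
    refine ge_of_tendsto' (tendsto_measure_iInter_atTop hnull hanti ⟨0, measure_ne_top _ _⟩)
      fun k => (measure_mono ?_).trans (hfin m k)
    exact fun ω ⟨a, ha, h⟩ => ⟨a, ha, fun b _ => h b⟩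
  have hset : {ω | ∃ a, ∀ b, X ω (a, b) ≤ c (a, b)}
      = ⋃ m : ℕ, {ω | ∃ a < m, ∀ b, X ω (a, b) ≤ c (a, b)} := by
    ext ω
    simp only [Set.mem_ofPred_eq, Set.mem_iUnion]
    exact ⟨fun ⟨a, h⟩ => ⟨a + 1, a, by omega, h⟩, fun ⟨_, a, _, h⟩ => ⟨a, h⟩⟩
  have hmono : Monotone fun m : ℕ => {ω | ∃ a < m, ∀ b, X ω (a, b) ≤ c (a, b)} :=
    fun m m' hm ω ⟨a, ha, h⟩ => ⟨a, ha.trans_le hm, h⟩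
  rw [hset]
  refine le_of_tendsto' (tendsto_measure_iUnion_atTop hmono) fun m => (hmk m).trans ?_
  exact measure_mono fun ω ⟨a, _, h⟩ => ⟨a, h⟩

/-! ### The min-max functional -/

section MinMax

variable {p n : ℕ} {W : Set (Fin p → ℝ)} {U : Set (Fin n → ℝ)}
  {L L' : (Fin p → ℝ) → (Fin n → ℝ) → ℝ}

/-- `L` is continuous on `W × U`. -/
abbrev JointlyContinuousOn (W : Set (Fin p → ℝ)) (U : Set (Fin n → ℝ))
    (L : (Fin p → ℝ) → (Fin n → ℝ) → ℝ) : Prop :=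
  ContinuousOn (fun x : (Fin p → ℝ) × (Fin n → ℝ) => L x.1 x.2) (W ×ˢ U)

lemma exists_abs_le_of_jointlyContinuousOn (hW : IsCompact W) (hU : IsCompact U)
    (hL : JointlyContinuousOn W U L) : ∃ C, ∀ w ∈ W, ∀ u ∈ U, |L w u| ≤ C := by
  obtain ⟨C, hC⟩ := (hW.prod hU).exists_bound_of_continuousOn hL
  exact ⟨C, fun w hw u hu => hC (w, u) ⟨hw, hu⟩⟩

lemma innerMax_le (hU : U.Nonempty) {w : Fin p → ℝ} {c : ℝ} (h : ∀ u ∈ U, L w u ≤ c) :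
    innerMax U L w ≤ c :=
  have := hU.to_subtype
  ciSup_le fun u => h u u.2

lemma le_innerMax (hW : IsCompact W) (hU : IsCompact U) (hL : JointlyContinuousOn W U L)
    {w : Fin p → ℝ} (hw : w ∈ W) {u : Fin n → ℝ} (hu : u ∈ U) : L w u ≤ innerMax U L w := by
  obtain ⟨C, hC⟩ := exists_abs_le_of_jointlyContinuousOn hW hU hL
  exact le_ciSup (f := fun u : U => L w u)
    ⟨C, by rintro _ ⟨u, rfl⟩; exact (le_abs_self _).trans (hC w hw u u.2)⟩ ⟨u, hu⟩

lemma minMax_le_innerMax (hW : IsCompact W) (hU : IsCompact U) (hU' : U.Nonempty)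
    (hL : JointlyContinuousOn W U L) {w : Fin p → ℝ} (hw : w ∈ W) :
    minMax W U L ≤ innerMax U L w := by
  obtain ⟨C, hC⟩ := exists_abs_le_of_jointlyContinuousOn hW hU hL
  obtain ⟨u, hu⟩ := hU'
  refine ciInf_le (f := fun w : W => innerMax U L w) ⟨-C, ?_⟩ ⟨w, hw⟩
  rintro _ ⟨w, rfl⟩
  exact (neg_le_of_abs_le (hC w w.2 u hu)).trans (le_innerMax hW hU hL w.2 hu)

lemma le_minMax (hW : W.Nonempty) {c : ℝ} (h : ∀ w ∈ W, c ≤ innerMax U L w) : c ≤ minMax W U L :=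
  have := hW.to_subtype
  le_ciInf fun w => h w w.2

lemma exists_innerMax_lt_of_minMax_lt (hW : W.Nonempty) {c : ℝ} (h : minMax W U L < c) :
    ∃ w ∈ W, innerMax U L w < c := by
  by_contra! hcon
  exact absurd (le_minMax hW hcon) (not_le.2 h)

lemma minMax_mono (hW : IsCompact W) (hW' : W.Nonempty) (hU : IsCompact U) (hU' : U.Nonempty)
    (hL : JointlyContinuousOn W U L) (hL' : JointlyContinuousOn W U L')
    (h : ∀ w ∈ W, ∀ u ∈ U, L w u ≤ L' w u) : minMax W U L ≤ minMax W U L' :=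
  le_minMax hW' fun _ hw => (minMax_le_innerMax hW hU hU' hL hw).trans <|
    innerMax_le hU' fun _ hu => (h _ hw _ hu).trans (le_innerMax hW hU hL' hw hu)

/-- This turns the event into countably many conditions. Compactness of `U` lets a good `w` be moved
to a nearby point of the dense sequence, uniformly in `u`. The margin `1 / (N + 1)` survives the
passage from a dense set of `u` to all of `U`, where a strict inequality would not. -/
lemma minMax_lt_iff (hW : IsCompact W) (hW' : W.Nonempty) (hU : IsCompact U) (hU' : U.Nonempty)
    (hL : JointlyContinuousOn W U L) {dw : ℕ → W} (hdw : DenseRange dw) {du : ℕ → U}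
    (hdu : DenseRange du) {c : ℝ} :
    minMax W U L < c ↔ ∃ N : ℕ, ∃ i, ∀ j, L (dw i) (du j) ≤ c - 1 / ((N : ℝ) + 1) := by
  have hL2 : Continuous fun z : W × U => L z.1 z.2 := by
    have hc : Continuous fun z : W × U => ((z.1 : Fin p → ℝ), (z.2 : Fin n → ℝ)) := by fun_prop
    exact hL.comp_continuous hc fun z => ⟨z.1.2, z.2.2⟩
  constructor
  · intro h
    obtain ⟨w, hw, hlt⟩ := exists_innerMax_lt_of_minMax_lt hW' h
    obtain ⟨N, hN⟩ := exists_nat_one_div_lt (sub_pos.2 hlt)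
    refine ⟨N, ?_⟩
    have hcomp : CompactSpace U := isCompact_iff_compactSpace.1 hU
    have hev : ∀ᶠ w' : W in 𝓝 (⟨w, hw⟩ : W), ∀ u ∈ (Set.univ : Set U),
        L w' u < c - 1 / ((N : ℝ) + 1) := by
      refine isCompact_univ.eventually_forall_of_forall_eventually fun u _ => ?_
      refine hL2.continuousAt.eventually_lt continuousAt_const ?_
      have := le_innerMax hW hU hL hw u.2
      show L w u < _
      linarith
    obtain ⟨_, ⟨i, rfl⟩, hw'⟩ := hdw.inter_nhds_nonempty hev
    exact ⟨i, fun j => (hw' (du j) (Set.mem_univ _)).le⟩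
  · rintro ⟨N, i, h⟩
    have hall : ∀ u : U, L (dw i) u ≤ c - 1 / ((N : ℝ) + 1) := fun u => by
      have hcl : IsClosed {u : U | L (dw i) u ≤ c - 1 / ((N : ℝ) + 1)} := by
        refine isClosed_le ?_ continuous_const
        exact hL2.comp (Continuous.prodMk_right (dw i))
      exact hdu.induction_on (p := fun u => L (dw i) u ≤ c - 1 / ((N : ℝ) + 1)) u hcl h
    have h1 := minMax_le_innerMax hW hU hU' hL (dw i).2
    have h2 := innerMax_le hU' fun u hu => hall ⟨u, hu⟩
    have h3 : 0 < 1 / ((N : ℝ) + 1) := Nat.one_div_pos_of_nat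
    linarith

end MinMax

/-! ### Measurability and Gordon comparison for min-max values of continuous processes -/

section ProcessComparison

variable {p n : ℕ} {Ω Ω' : Type*} [MeasurableSpace Ω] [MeasurableSpace Ω']
    {P : Measure Ω} {P' : Measure Ω'} {W : Set (Fin p → ℝ)} {U : Set (Fin n → ℝ)}
    {X : Ω → (Fin p → ℝ) × (Fin n → ℝ) → ℝ} {Y : Ω' → (Fin p → ℝ) × (Fin n → ℝ) → ℝ}
    {f : (Fin p → ℝ) → (Fin n → ℝ) → ℝ}

lemma aemeasurable_minMax (hW : IsCompact W) (hW' : W.Nonempty) (hU : IsCompact U)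
    (hU' : U.Nonempty) {L : Ω → (Fin p → ℝ) → (Fin n → ℝ) → ℝ}
    (hL : ∀ ω, JointlyContinuousOn W U (L ω)) (hLm : ∀ w u, AEMeasurable (fun ω => L ω w u) P) :
    AEMeasurable (fun ω => minMax W U (L ω)) P := by
  have := hW'.to_subtype
  have := hU'.to_subtype
  -- The processes are only a.e. measurable, so measurability is tested on the completed σ-algebra.
  refine NullMeasurable.aemeasurable (measurable_of_Iio (α := ℝ) (δ := NullMeasurableSpace Ω P) fun c => ?_)
  have hset : (fun ω => minMax W U (L ω)) ⁻¹' Set.Iio c = ⋃ N : ℕ, ⋃ i, ⋂ j,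
      {ω | L ω (TopologicalSpace.denseSeq W i) (TopologicalSpace.denseSeq U j)
        ≤ c - 1 / ((N : ℝ) + 1)} := by
    ext ω
    simp only [Set.mem_preimage, Set.mem_Iio, Set.mem_ofPred_eq, Set.mem_iUnion, Set.mem_iInter]
    exact minMax_lt_iff hW hW' hU hU' (hL ω) (TopologicalSpace.denseRange_denseSeq W)
      (TopologicalSpace.denseRange_denseSeq U)
  change NullMeasurableSet ((fun ω => minMax W U (L ω)) ⁻¹' Set.Iio c) P
  rw [hset]
  exact .iUnion fun N => .iUnion fun i => .iInter fun j =>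
    nullMeasurableSet_le (hLm _ _) aemeasurable_const

/-- **Gordon's inequality** for the min-max value of Gaussian processes. -/
theorem measure_minMax_lt_le [IsProbabilityMeasure P] [IsProbabilityMeasure P']
    {K K' : (Fin p → ℝ) × (Fin n → ℝ) → (Fin p → ℝ) × (Fin n → ℝ) → ℝ}
    (hX : IsCenteredGaussianProcess P X K) (hY : IsCenteredGaussianProcess P' Y K')
    (hK : ∀ k l, K k l = K l k) (hK' : ∀ k l, K' k l = K' l k)
    (hle : ∀ k l, K' k l ≤ K k l) (heq : ∀ k l, k.1 = l.1 → K k l = K' k l)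
    (hXc : ∀ ω, Continuous (X ω)) (hYc : ∀ ω, Continuous (Y ω))
    (hW : IsCompact W) (hW' : W.Nonempty) (hU : IsCompact U) (hU' : U.Nonempty)
    (hf : JointlyContinuousOn W U f) (c : ℝ) :
    P {ω | minMax W U (fun w u => X ω (w, u) + f w u) < c}
      ≤ P' {ω | minMax W U (fun w u => Y ω (w, u) + f w u) < c} := by
  have := hW'.to_subtype
  have := hU'.to_subtype
  let dw := TopologicalSpace.denseSeq W
  let du := TopologicalSpace.denseSeq U
  have hX2 : ∀ ω, JointlyContinuousOn W U fun w u => X ω (w, u) + f w u := fun ω =>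
    (hXc ω).continuousOn.add hf
  have hY2 : ∀ ω, JointlyContinuousOn W U fun w u => Y ω (w, u) + f w u := fun ω =>
    (hYc ω).continuousOn.add hf
  have hiff := fun L hL => minMax_lt_iff (L := L) (c := c) hW hW' hU hU' hL
    (TopologicalSpace.denseRange_denseSeq W) (TopologicalSpace.denseRange_denseSeq U)
  have hset : {ω | minMax W U (fun w u => X ω (w, u) + f w u) < c} = ⋃ N : ℕ,
      {ω | ∃ i, ∀ j, X ω (dw i, du j) + f (dw i) (du j) ≤ c - 1 / ((N : ℝ) + 1)} := by
    ext ω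
    simp only [Set.mem_ofPred_eq, Set.mem_iUnion]
    exact hiff _ (hX2 ω)
  have hmono : Monotone fun N : ℕ =>
      {ω | ∃ i, ∀ j, X ω (dw i, du j) + f (dw i) (du j) ≤ c - 1 / ((N : ℝ) + 1)} := by
    rintro N N' hN ω ⟨i, h⟩
    refine ⟨i, fun j => (h j).trans ?_⟩
    have := Nat.one_div_le_one_div (α := ℝ) hN
    linarith
  rw [hset]
  refine le_of_tendsto' (tendsto_measure_iUnion_atTop hmono) fun N => ?_
  let e : ℕ × ℕ → (Fin p → ℝ) × (Fin n → ℝ) := fun q => (dw q.1, du q.2)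
  have hcount := gordon_countable (hX.comp e) (hY.comp e) (fun _ _ => hK _ _) (fun _ _ => hK' _ _)
    (fun _ _ => hle _ _) (fun k l hkl => heq _ _ (by simp only [e, hkl]))
    -- The deterministic term `f` is absorbed into the thresholds, which is why these may vary with
    -- the index.
    (fun q => c - 1 / ((N : ℝ) + 1) - f (e q).1 (e q).2)
  refine (measure_mono ?_).trans (hcount.trans (measure_mono ?_))
  · exact fun ω ⟨i, h⟩ => ⟨i, fun j => le_sub_iff_add_le.2 (h j)⟩
  · exact fun ω ⟨i, h⟩ => (hiff _ (hY2 ω)).2 ⟨N, i, fun j => le_sub_iff_add_le.1 (h j)⟩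

end ProcessComparison

/-! ### Quadratic seminorms -/

section QuadNorm

variable {d : ℕ} {S : Matrix (Fin d) (Fin d) ℝ}

lemma transpose_sqrt (S : Matrix (Fin d) (Fin d) ℝ) : (CFC.sqrt S)ᵀ = CFC.sqrt S := by
  have := (CFC.sqrt_nonneg S).isSelfAdjoint
  rwa [isSelfAdjoint_iff, star_eq_conjTranspose, conjTranspose_eq_transpose_of_trivial] at this

lemma dotProduct_sqrt_mulVec (hS : S.PosSemidef) (v w : Fin d → ℝ) :
    (CFC.sqrt S *ᵥ v) ⬝ᵥ (CFC.sqrt S *ᵥ w) = v ⬝ᵥ (S *ᵥ w) := by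
  rw [dotProduct_comm, dotProduct_mulVec, ← mulVec_transpose, transpose_sqrt, mulVec_mulVec,
    CFC.sqrt_mul_sqrt_self S hS.nonneg, dotProduct_comm]

lemma quadNorm_nonneg (S : Matrix (Fin d) (Fin d) ℝ) (v : Fin d → ℝ) : 0 ≤ quadNorm S v :=
  Real.sqrt_nonneg _

lemma quadNorm_mul_self (hS : S.PosSemidef) (v : Fin d → ℝ) :
    quadNorm S v * quadNorm S v = v ⬝ᵥ (S *ᵥ v) := by
  refine Real.mul_self_sqrt ?_
  rw [← dotProduct_sqrt_mulVec hS]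
  exact Finset.sum_nonneg fun _ _ => mul_self_nonneg _

/-- Cauchy–Schwarz for the vectors `S^{1/2} v` and `S^{1/2} w`. -/
lemma dotProduct_mulVec_le_quadNorm (hS : S.PosSemidef) (v w : Fin d → ℝ) :
    v ⬝ᵥ (S *ᵥ w) ≤ quadNorm S v * quadNorm S w := by
  unfold quadNorm
  rw [← dotProduct_sqrt_mulVec hS v w, ← dotProduct_sqrt_mulVec hS v v,
    ← dotProduct_sqrt_mulVec hS w w]
  simpa only [dotProduct, sq] using
    Real.sum_mul_le_sqrt_mul_sqrt Finset.univ (CFC.sqrt S *ᵥ v) (CFC.sqrt S *ᵥ w)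

lemma dotProduct_mulVec_symm (hS : S.PosSemidef) (v w : Fin d → ℝ) :
    v ⬝ᵥ (S *ᵥ w) = w ⬝ᵥ (S *ᵥ v) := by
  rw [← dotProduct_sqrt_mulVec hS, dotProduct_comm, dotProduct_sqrt_mulVec hS]

lemma continuous_quadNorm (S : Matrix (Fin d) (Fin d) ℝ) : Continuous (quadNorm S) := by
  unfold quadNorm dotProduct
  fun_prop

end QuadNorm

/-! ### The covariance functions of the two processes -/

section Covariance

variable {p n M : ℕ} (S : Fin M → Matrix (Fin p) (Fin p) ℝ) (T : Fin M → Matrix (Fin n) (Fin n) ℝ)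

/-- The covariance function of `(w, u) ↦ wᵀ H u`. -/
def primaryCov (q q' : (Fin p → ℝ) × (Fin n → ℝ)) : ℝ :=
  ∑ l, (q.1 ⬝ᵥ (S l *ᵥ q'.1)) * (q.2 ⬝ᵥ (T l *ᵥ q'.2))

/-- The covariance function of `(w, u) ↦ ∑_l γ_l ‖w‖_{S_l} ‖u‖_{T_l}`. -/
def normCov (q q' : (Fin p → ℝ) × (Fin n → ℝ)) : ℝ :=
  ∑ l, (quadNorm (S l) q.1 * quadNorm (T l) q.2) * (quadNorm (S l) q'.1 * quadNorm (T l) q'.2)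

/-- The covariance function of the auxiliary process. -/
def auxiliaryCov (q q' : (Fin p → ℝ) × (Fin n → ℝ)) : ℝ :=
  ∑ l, (quadNorm (S l) q.1 * quadNorm (S l) q'.1 * (q.2 ⬝ᵥ (T l *ᵥ q'.2))
    + (q.1 ⬝ᵥ (S l *ᵥ q'.1)) * (quadNorm (T l) q.2 * quadNorm (T l) q'.2))

variable {S T}

lemma primaryCov_symm (hS : ∀ l, (S l).PosSemidef) (hT : ∀ l, (T l).PosSemidef)
    (q q' : (Fin p → ℝ) × (Fin n → ℝ)) : primaryCov S T q q' = primaryCov S T q' q :=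
  Finset.sum_congr rfl fun l _ => by
    rw [dotProduct_mulVec_symm (hS l) q.1, dotProduct_mulVec_symm (hT l) q.2]

lemma normCov_symm (q q' : (Fin p → ℝ) × (Fin n → ℝ)) : normCov S T q q' = normCov S T q' q :=
  Finset.sum_congr rfl fun _ _ => mul_comm _ _

lemma auxiliaryCov_symm (hS : ∀ l, (S l).PosSemidef) (hT : ∀ l, (T l).PosSemidef)
    (q q' : (Fin p → ℝ) × (Fin n → ℝ)) : auxiliaryCov S T q q' = auxiliaryCov S T q' q :=
  Finset.sum_congr rfl fun l _ => by
    rw [dotProduct_mulVec_symm (hS l) q.1, dotProduct_mulVec_symm (hT l) q.2]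
    ring

/-- With `s`, `t` the two bilinear forms and `a`, `b` the products of seminorms, each summand is `s
t + a b - a t - s b = (a - s)(b - t)`. The covariance `normCov` is chosen to complete this
factorization. -/
lemma primaryCov_add_normCov_sub (q q' : (Fin p → ℝ) × (Fin n → ℝ)) :
    primaryCov S T q q' + normCov S T q q' - auxiliaryCov S T q q'
      = ∑ l, (quadNorm (S l) q.1 * quadNorm (S l) q'.1 - q.1 ⬝ᵥ (S l *ᵥ q'.1))
        * (quadNorm (T l) q.2 * quadNorm (T l) q'.2 - q.2 ⬝ᵥ (T l *ᵥ q'.2)) := by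
  rw [primaryCov, normCov, auxiliaryCov, ← Finset.sum_add_distrib, ← Finset.sum_sub_distrib]
  exact Finset.sum_congr rfl fun l _ => by ring

lemma auxiliaryCov_le (hS : ∀ l, (S l).PosSemidef) (hT : ∀ l, (T l).PosSemidef)
    (q q' : (Fin p → ℝ) × (Fin n → ℝ)) :
    auxiliaryCov S T q q' ≤ primaryCov S T q q' + normCov S T q q' := by
  rw [← sub_nonneg, primaryCov_add_normCov_sub]
  exact Finset.sum_nonneg fun l _ => mul_nonneg
    (sub_nonneg.2 (dotProduct_mulVec_le_quadNorm (hS l) _ _))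
    (sub_nonneg.2 (dotProduct_mulVec_le_quadNorm (hT l) _ _))

lemma primaryCov_add_normCov_of_fst_eq (hS : ∀ l, (S l).PosSemidef)
    (q q' : (Fin p → ℝ) × (Fin n → ℝ)) (h : q.1 = q'.1) :
    primaryCov S T q q' + normCov S T q q' = auxiliaryCov S T q q' := by
  rw [← sub_eq_zero, primaryCov_add_normCov_sub]
  exact Finset.sum_eq_zero fun l _ => by rw [h, quadNorm_mul_self (hS l), sub_self, zero_mul]

lemma isCenteredGaussianProcess_norm (S : Fin M → Matrix (Fin p) (Fin p) ℝ)
    (T : Fin M → Matrix (Fin n) (Fin n) ℝ) :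
    IsCenteredGaussianProcess (Measure.pi fun _ : Fin M => gaussianReal 0 1)
      (fun z q => ∑ l, z l * (quadNorm (S l) q.1 * quadNorm (T l) q.2)) (normCov S T) :=
  IsCenteredGaussianProcess.pi fun l => IsCenteredGaussianProcess.gaussianReal
    fun q : (Fin p → ℝ) × (Fin n → ℝ) => quadNorm (S l) q.1 * quadNorm (T l) q.2

/-- The auxiliary process without the deterministic term. -/
def auxiliaryProcess (S : Fin M → Matrix (Fin p) (Fin p) ℝ) (T : Fin M → Matrix (Fin n) (Fin n) ℝ)
    (h : Fin M → Fin n → ℝ) (g : Fin M → Fin p → ℝ) (q : (Fin p → ℝ) × (Fin n → ℝ)) : ℝ :=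
  ∑ l, (quadNorm (S l) q.1 * (h l ⬝ᵥ (CFC.sqrt (T l) *ᵥ q.2))
      + (q.1 ⬝ᵥ (CFC.sqrt (S l) *ᵥ g l)) * quadNorm (T l) q.2)

lemma continuous_auxiliaryProcess (S : Fin M → Matrix (Fin p) (Fin p) ℝ)
    (T : Fin M → Matrix (Fin n) (Fin n) ℝ) (h : Fin M → Fin n → ℝ) (g : Fin M → Fin p → ℝ) :
    Continuous (auxiliaryProcess S T h g) := by
  unfold auxiliaryProcess
  refine continuous_finsetSum _ fun l _ => ?_
  have h1 := (continuous_quadNorm (S l)).comp (continuous_fst (X := Fin p → ℝ) (Y := Fin n → ℝ))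
  have h2 := (continuous_quadNorm (T l)).comp (continuous_snd (X := Fin p → ℝ) (Y := Fin n → ℝ))
  have h3 : Continuous fun q : (Fin p → ℝ) × (Fin n → ℝ) => h l ⬝ᵥ (CFC.sqrt (T l) *ᵥ q.2) := by
    unfold dotProduct; fun_prop
  have h4 : Continuous fun q : (Fin p → ℝ) × (Fin n → ℝ) => q.1 ⬝ᵥ (CFC.sqrt (S l) *ᵥ g l) := by
    unfold dotProduct; fun_prop
  exact (h1.mul h3).add (h4.mul h2)

lemma isCenteredGaussianProcess_auxiliary {Ω : Type*} [MeasurableSpace Ω] {P : Measure Ω}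
    (hS : ∀ l, (S l).PosSemidef) (hT : ∀ l, (T l).PosSemidef)
    {h : Ω → Fin M → Fin n → ℝ} {g : Ω → Fin M → Fin p → ℝ} (hhg : IsIndepStdGaussian P h g) :
    IsCenteredGaussianProcess P (fun ω => auxiliaryProcess S T (h ω) (g ω))
      (auxiliaryCov S T) := by
  have hn : IsProbabilityMeasure (stdGaussianVec n) := by unfold stdGaussianVec; infer_instance
  have hp : IsProbabilityMeasure (stdGaussianVec p) := by unfold stdGaussianVec; infer_instance
  have h1 := IsCenteredGaussianProcess.pi fun l : Fin M =>
    IsCenteredGaussianProcess.stdGaussianVec fun q : (Fin p → ℝ) × (Fin n → ℝ) =>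
      quadNorm (S l) q.1 • (CFC.sqrt (T l) *ᵥ q.2)
  have h2 := IsCenteredGaussianProcess.pi fun l : Fin M =>
    IsCenteredGaussianProcess.stdGaussianVec fun q : (Fin p → ℝ) × (Fin n → ℝ) =>
      quadNorm (T l) q.2 • (CFC.sqrt (S l) *ᵥ q.1)
  have h3 := ((h1.prod h2).of_hasLaw hhg).congr (K' := auxiliaryCov S T) ?_
  · convert h3 using 1
    funext ω q
    rw [auxiliaryProcess, ← Finset.sum_add_distrib]
    refine Finset.sum_congr rfl fun l _ => ?_
    simp only [smul_dotProduct, smul_eq_mul]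
    rw [dotProduct_comm (h ω l), dotProduct_mulVec q.1, ← mulVec_transpose, transpose_sqrt]
    ring
  · intro q q'
    rw [auxiliaryCov, ← Finset.sum_add_distrib]
    refine Finset.sum_congr rfl fun l _ => ?_
    simp only [smul_dotProduct, dotProduct_smul, smul_eq_mul, dotProduct_sqrt_mulVec (hS l),
      dotProduct_sqrt_mulVec (hT l)]
    ring

lemma sum_sum_mul_eq (A : Matrix (Fin p) (Fin p) ℝ) (B : Matrix (Fin n) (Fin n) ℝ)
    (w w' : Fin p → ℝ) (u u' : Fin n → ℝ) :
    ∑ a : Fin p × Fin n, ∑ b : Fin p × Fin n,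
      (w a.1 * u a.2) * ((w' b.1 * u' b.2) * (A a.1 b.1 * B a.2 b.2))
      = (w ⬝ᵥ (A *ᵥ w')) * (u ⬝ᵥ (B *ᵥ u')) := by
  simp only [Fintype.sum_prod_type]
  have h1 : w ⬝ᵥ (A *ᵥ w') = ∑ j, ∑ j', w j * (w' j' * A j j') := by
    simp only [dotProduct, mulVec, Finset.mul_sum]
    exact Finset.sum_congr rfl fun _ _ => Finset.sum_congr rfl fun _ _ => by ring
  have h2 : u ⬝ᵥ (B *ᵥ u') = ∑ i, ∑ i', u i * (u' i' * B i i') := by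
    simp only [dotProduct, mulVec, Finset.mul_sum]
    exact Finset.sum_congr rfl fun _ _ => Finset.sum_congr rfl fun _ _ => by ring
  rw [h1, h2, Finset.sum_mul_sum]
  refine Finset.sum_congr rfl fun j _ => Finset.sum_congr rfl fun i _ => ?_
  rw [Finset.sum_mul_sum]
  exact Finset.sum_congr rfl fun _ _ => Finset.sum_congr rfl fun _ _ => by ring

lemma isCenteredGaussianProcess_primary {Ω : Type*} [MeasurableSpace Ω] {P : Measure Ω}
    [IsProbabilityMeasure P] {H : Ω → Matrix (Fin p) (Fin n) ℝ} (hH : IsLowRankGaussian P S T H) :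
    IsCenteredGaussianProcess P (fun ω q => q.1 ⬝ᵥ (H ω *ᵥ q.2)) (primaryCov S T) := by
  intro κ _ e
  have hV := hH.gaussian
  have hmem : ∀ a : Fin p × Fin n, MemLp (fun ω => H ω a.1 a.2) 2 P := fun a =>
    hV.memLp_two.eval a
  have hm : AEMeasurable (fun ω => fun a : Fin p × Fin n => H ω a.1 a.2) P := hV.aemeasurable
  have hZ : ∀ (q : (Fin p → ℝ) × (Fin n → ℝ)) ω, q.1 ⬝ᵥ (H ω *ᵥ q.2)
      = ∑ a : Fin p × Fin n, (q.1 a.1 * q.2 a.2) * H ω a.1 a.2 := fun q ω => by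
    simp only [dotProduct, mulVec, Finset.mul_sum, Fintype.sum_prod_type]
    exact Finset.sum_congr rfl fun j _ => Finset.sum_congr rfl fun i _ => by ring
  simp_rw [hZ]
  set Z : (Fin p → ℝ) × (Fin n → ℝ) → Ω → ℝ := fun q ω =>
    ∑ a : Fin p × Fin n, (q.1 a.1 * q.2 a.2) * H ω a.1 a.2 with hZdef
  have hZmem : ∀ q, MemLp (Z q) 2 P := fun q =>
    memLp_finsetSum _ fun a _ => (hmem a).const_mul _
  have hZmean : ∀ q, ∫ ω, Z q ω ∂P = 0 := fun q => by
    rw [integral_finsetSum _ fun a _ => ((hmem a).integrable one_le_two).const_mul _]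
    simp [integral_const_mul, hH.centred]
  have hcov : ∀ q q', cov[Z q, Z q'; P] = primaryCov S T q q' := fun q q' => by
    rw [hZdef, covariance_fun_sum_fun_sum (fun a => (hmem a).const_mul _)
      fun a => (hmem a).const_mul _]
    simp_rw [covariance_const_mul_left, covariance_const_mul_right, hH.cov, Finset.mul_sum]
    simp_rw [primaryCov, ← sum_sum_mul_eq]
    symm
    rw [Finset.sum_comm]
    exact Finset.sum_congr rfl fun a _ => Finset.sum_comm
  change IsCenteredGaussian P (fun ω k => Z (e k) ω) _
  refine ⟨aemeasurable_pi_iff.2 fun k => (hZmem (e k)).aestronglyMeasurable.aemeasurable,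
    fun c => ?_⟩
  -- A linear combination of the values `wᵀHu` is a linear functional of the entries of `H`, so
  -- joint Gaussianity reduces the characteristic function to a mean and a variance.
  let L : StrongDual ℝ (Fin p × Fin n → ℝ) := ∑ k, c k • ∑ a : Fin p × Fin n,
    ((e k).1 a.1 * (e k).2 a.2) • ContinuousLinearMap.proj (R := ℝ)
      (φ := fun _ : Fin p × Fin n => ℝ) a
  have hL : ∀ ω, L (fun a => H ω a.1 a.2) = ∑ k, c k * Z (e k) ω :=
    fun ω => by simp [L, hZdef]
  have h := hV.charFunDual_map_eq_fun L
  rw [charFunDual_apply, integral_map hm (Continuous.aestronglyMeasurable (by fun_prop))] at h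
  simp_rw [hL] at h
  have hmean : ∫ ω, ((∑ k, c k * Z (e k) ω : ℝ) : ℂ) ∂P = 0 := by
    rw [integral_complex_ofReal,
      integral_finsetSum _ fun k _ => ((hZmem (e k)).integrable one_le_two).const_mul _]
    simp [integral_const_mul, hZmean]
  have hvar : Var[fun ω => ∑ k, c k * Z (e k) ω; P]
      = c ⬝ᵥ ((Matrix.of fun k l => primaryCov S T (e k) (e l)) *ᵥ c) := by
    rw [← covariance_self (Finset.aemeasurable_fun_sum _ fun k _ =>
      (hZmem (e k)).aestronglyMeasurable.aemeasurable.const_mul _),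
      covariance_fun_sum_fun_sum (fun k => (hZmem (e k)).const_mul _)
        fun k => (hZmem (e k)).const_mul _]
    simp_rw [covariance_const_mul_left, covariance_const_mul_right]
    rw [dotProduct]
    refine Finset.sum_congr rfl fun k _ => ?_
    rw [mulVec, dotProduct, Finset.mul_sum]
    refine Finset.sum_congr rfl fun l _ => ?_
    rw [Matrix.of_apply, ← hcov]
    ring
  rw [hvar] at h
  refine h.trans ?_
  rw [← integral_complex_ofReal, hmean]
  simp [neg_div]

end Covariance

/-! ### Duality of the min-max functional -/

section Duality

variable {p n : ℕ} {W : Set (Fin p → ℝ)} {U : Set (Fin n → ℝ)}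
  {L : (Fin p → ℝ) → (Fin n → ℝ) → ℝ}

lemma JointlyContinuousOn.neg_swap (hL : JointlyContinuousOn W U L) :
    JointlyContinuousOn U W fun u w => -L w u :=
  (hL.comp continuous_swap.continuousOn fun _ hx => ⟨hx.2, hx.1⟩).neg

/-- Weak duality. -/
lemma neg_minMax_swap_le (hW : IsCompact W) (hW' : W.Nonempty) (hU : IsCompact U)
    (hU' : U.Nonempty) (hL : JointlyContinuousOn W U L) :
    -minMax U W (fun u w => -L w u) ≤ minMax W U L := by
  refine le_minMax hW' fun w hw => neg_le.1 <| le_minMax hU' fun u hu => ?_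
  exact (neg_le_neg (le_innerMax hW hU hL hw hu)).trans
    (le_innerMax (L := fun u w => -L w u) hU hW hL.neg_swap hu hw)

/-- Strong duality for convex-concave functions. -/
lemma minMax_le_neg_minMax_swap (hW : IsCompact W) (hW' : W.Nonempty) (hU : IsCompact U)
    (hU' : U.Nonempty) (hL : JointlyContinuousOn W U L)
    (hcx : ∀ u ∈ U, ConvexOn ℝ W fun w => L w u) (hcv : ∀ w ∈ W, ConcaveOn ℝ U fun u => L w u) :
    minMax W U L ≤ -minMax U W (fun u w => -L w u) := by
  obtain ⟨w₀, hw₀⟩ := id hW'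
  obtain ⟨u₀, hu₀⟩ := id hU'
  have hc1 : ∀ u ∈ U, ContinuousOn (fun w => L w u) W := fun u hu =>
    hL.comp (Continuous.prodMk_left u).continuousOn fun _ hw => ⟨hw, hu⟩
  have hc2 : ∀ w ∈ W, ContinuousOn (fun u => L w u) U := fun w hw =>
    hL.comp (Continuous.prodMk_right w).continuousOn fun _ hu => ⟨hw, hu⟩
  -- The saddle point gives `L a u ≤ L w b` for all `w` and `u`: `a` bounds the min-max from above
  -- and `b` the max-min from below.
  obtain ⟨a, ha, b, hb, hab⟩ := Sion.exists_isSaddlePointOn (X := W) (Y := U) (f := L) hW'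
    (hcx u₀ hu₀).1 hW (fun u hu => (hc1 u hu).lowerSemicontinuousOn)
    (fun u hu => (hcx u hu).quasiconvexOn) (hcv w₀ hw₀).1 hU' hU
    (fun w hw => (hc2 w hw).upperSemicontinuousOn) (fun w hw => (hcv w hw).quasiconcaveOn)
  refine le_neg.1 <| (minMax_le_innerMax hU hW hW' hL.neg_swap hb).trans ?_
  refine innerMax_le hW' fun w hw => neg_le_neg ?_
  exact (minMax_le_innerMax hW hU hU' hL ha).trans (innerMax_le hU' fun u hu => hab w hw u hu)

end Duality

/-! ### Comparison of the primary and the auxiliary problem -/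

section Comparison

lemma half_le_gaussianReal_Iic_zero : (1 / 2 : ℝ) ≤ (gaussianReal 0 1).real (Set.Iic 0) := by
  have h1 : (gaussianReal 0 1).real (Set.Ici 0) = (gaussianReal 0 1).real (Set.Iic 0) := by
    have h : (gaussianReal 0 1).map (fun x => -x) = gaussianReal 0 1 := by
      rw [gaussianReal_map_neg, neg_zero]
    conv_lhs => rw [← h]
    rw [map_measureReal_apply measurable_neg measurableSet_Ici]
    congr 1
    ext x
    simp
  have h2 := measureReal_union_le (μ := gaussianReal 0 1) (Set.Iic (0 : ℝ)) (Set.Ici 0)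
  rw [Set.Iic_union_Ici, probReal_univ, h1] at h2
  linarith

variable {p n M : ℕ} {S : Fin M → Matrix (Fin p) (Fin p) ℝ} {T : Fin M → Matrix (Fin n) (Fin n) ℝ}
  {Ω Ω' : Type*} [MeasurableSpace Ω] [MeasurableSpace Ω']
  {P : Measure Ω} {P' : Measure Ω'} [IsProbabilityMeasure P] [IsProbabilityMeasure P']
  {W : Set (Fin p → ℝ)} {U : Set (Fin n → ℝ)}
  {X : Ω → (Fin p → ℝ) × (Fin n → ℝ) → ℝ} {Y : Ω' → (Fin p → ℝ) × (Fin n → ℝ) → ℝ}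
  {f : (Fin p → ℝ) → (Fin n → ℝ) → ℝ}

omit [IsProbabilityMeasure P] in
lemma IsCenteredGaussianProcess.aemeasurable_minMax {K : (Fin p → ℝ) × (Fin n → ℝ) →
      (Fin p → ℝ) × (Fin n → ℝ) → ℝ} (hX : IsCenteredGaussianProcess P X K)
    (hXc : ∀ ω, Continuous (X ω)) (hW : IsCompact W) (hW' : W.Nonempty) (hU : IsCompact U)
    (hU' : U.Nonempty) (hf : JointlyContinuousOn W U f) :
    AEMeasurable (fun ω => minMax W U fun w u => X ω (w, u) + f w u) P :=
  DependentCGMT.aemeasurable_minMax hW hW' hU hU' (fun ω => (hXc ω).continuousOn.add hf)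
    fun w u => (hX.aemeasurable (w, u)).add_const _

/-- Gordon's inequality is applied to `X + N`, with `N = ∑_l γ_l ‖w‖ ‖u‖` on an independent factor.
When all `γ_l ≤ 0` one has `N ≤ 0`, so the event for `X` times this orthant is contained in the
event for `X + N`; the orthant costs the factor `2^M`. -/
theorem measureReal_minMax_lt_le (hS : ∀ l, (S l).PosSemidef) (hT : ∀ l, (T l).PosSemidef)
    (hX : IsCenteredGaussianProcess P X (primaryCov S T))
    (hY : IsCenteredGaussianProcess P' Y (auxiliaryCov S T))
    (hXc : ∀ ω, Continuous (X ω)) (hYc : ∀ ω, Continuous (Y ω))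
    (hW : IsCompact W) (hW' : W.Nonempty) (hU : IsCompact U) (hU' : U.Nonempty)
    (hf : JointlyContinuousOn W U f) (c : ℝ) :
    P.real {ω | minMax W U (fun w u => X ω (w, u) + f w u) < c}
      ≤ 2 ^ M * P'.real {ω | minMax W U (fun w u => Y ω (w, u) + f w u) < c} := by
  set γ : Measure (Fin M → ℝ) := Measure.pi fun _ => gaussianReal 0 1 with hγ
  let N : (Fin M → ℝ) → (Fin p → ℝ) × (Fin n → ℝ) → ℝ := fun z q =>
    ∑ l, z l * (quadNorm (S l) q.1 * quadNorm (T l) q.2)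
  have hN : IsCenteredGaussianProcess γ N (normCov S T) := isCenteredGaussianProcess_norm S T
  have hNc : ∀ z, Continuous (N z) := fun z => continuous_finsetSum _ fun l _ =>
    continuous_const.mul (((continuous_quadNorm (S l)).comp continuous_fst).mul
      ((continuous_quadNorm (T l)).comp continuous_snd))
  have hXN : ∀ z : Ω × (Fin M → ℝ), Continuous fun q => X z.1 q + N z.2 q := fun z =>
    (hXc z.1).add (hNc z.2)
  have hcmp := measure_minMax_lt_le (hX.prod hN) hY
    (fun q q' => by rw [primaryCov_symm hS hT, normCov_symm]) (auxiliaryCov_symm hS hT)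
    (auxiliaryCov_le hS hT) (primaryCov_add_normCov_of_fst_eq hS) hXN hYc hW hW' hU hU' hf c
  have hsub : {ω | minMax W U (fun w u => X ω (w, u) + f w u) < c} ×ˢ
      (Set.univ.pi fun _ : Fin M => Set.Iic (0 : ℝ)) ⊆
      {z : Ω × (Fin M → ℝ) | minMax W U (fun w u => X z.1 (w, u) + N z.2 (w, u) + f w u) < c} := by
    rintro ⟨ω, z⟩ ⟨h1, h2⟩
    refine lt_of_le_of_lt (minMax_mono hW hW' hU hU' ((hXN (ω, z)).continuousOn.add hf)
      ((hXc ω).continuousOn.add hf) fun w _ u _ => ?_) h1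
    have : N z (w, u) ≤ 0 := Finset.sum_nonpos fun l _ => mul_nonpos_of_nonpos_of_nonneg
      (h2 l (Set.mem_univ l)) (mul_nonneg (quadNorm_nonneg _ _) (quadNorm_nonneg _ _))
    linarith
  have h := ENNReal.toReal_mono (measure_ne_top P' _) ((measure_mono hsub).trans hcmp)
  rw [Measure.prod_prod, ENNReal.toReal_mul, hγ, Measure.pi_pi, ENNReal.toReal_prod] at h
  have hpow : (1 / 2 : ℝ) ^ M ≤ ∏ _l : Fin M, (gaussianReal 0 1 (Set.Iic 0)).toReal := by
    rw [Finset.prod_const, Finset.card_univ, Fintype.card_fin]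
    exact pow_le_pow_left₀ (by norm_num) half_le_gaussianReal_Iic_zero M
  have h2 : P.real {ω | minMax W U (fun w u => X ω (w, u) + f w u) < c} * (1 / 2 : ℝ) ^ M
      ≤ P'.real {ω | minMax W U (fun w u => Y ω (w, u) + f w u) < c} :=
    (mul_le_mul_of_nonneg_left hpow measureReal_nonneg).trans h
  calc _ = 2 ^ M * (P.real {ω | minMax W U (fun w u => X ω (w, u) + f w u) < c}
        * (1 / 2 : ℝ) ^ M) := by
        rw [mul_comm (P.real _), ← mul_assoc, ← mul_pow]; norm_num
    _ ≤ _ := by gcongr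

/-- A comparison of distribution functions for strict inequalities implies the one for
non-strict inequalities. -/
lemma measureReal_le_le_of_forall_lt {Ψ : Ω → ℝ} {ψ : Ω' → ℝ} (hψ : AEMeasurable ψ P') {C : ℝ}
    (h : ∀ c, P.real {ω | Ψ ω < c} ≤ C * P'.real {ω | ψ ω < c}) (c : ℝ) :
    P.real {ω | Ψ ω ≤ c} ≤ C * P'.real {ω | ψ ω ≤ c} := by
  have hset : {ω | ψ ω ≤ c} = ⋂ N : ℕ, {ω | ψ ω < c + 1 / ((N : ℝ) + 1)} := by
    ext ω
    simp only [Set.mem_ofPred_eq, Set.mem_iInter]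
    refine ⟨fun hω N => hω.trans_lt (lt_add_of_pos_right _ Nat.one_div_pos_of_nat), fun hω => ?_⟩
    refine le_of_forall_pos_lt_add fun ε hε => ?_
    obtain ⟨N, hN⟩ := exists_nat_one_div_lt hε
    linarith [hω N]
  have hanti : Antitone fun N : ℕ => {ω | ψ ω < c + 1 / ((N : ℝ) + 1)} := by
    intro N N' hN ω hω
    have := Nat.one_div_le_one_div (α := ℝ) hN
    have hω' : ψ ω < c + 1 / ((N' : ℝ) + 1) := hω
    show ψ ω < c + 1 / ((N : ℝ) + 1)
    linarith
  have hlim := (ENNReal.tendsto_toReal (measure_ne_top P' _)).comp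
    (tendsto_measure_iInter_atTop (fun N => nullMeasurableSet_lt hψ aemeasurable_const) hanti
      ⟨0, measure_ne_top P' _⟩)
  rw [hset]
  refine ge_of_tendsto' (hlim.const_mul C) fun N => le_trans ?_ (h (c + 1 / ((N : ℝ) + 1)))
  refine measureReal_mono fun ω (hω : Ψ ω ≤ c) => ?_
  have : 0 < 1 / ((N : ℝ) + 1) := Nat.one_div_pos_of_nat
  show Ψ ω < c + 1 / ((N : ℝ) + 1)
  linarith

theorem measureReal_minMax_le_le (hS : ∀ l, (S l).PosSemidef) (hT : ∀ l, (T l).PosSemidef)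
    (hX : IsCenteredGaussianProcess P X (primaryCov S T))
    (hY : IsCenteredGaussianProcess P' Y (auxiliaryCov S T))
    (hXc : ∀ ω, Continuous (X ω)) (hYc : ∀ ω, Continuous (Y ω))
    (hW : IsCompact W) (hW' : W.Nonempty) (hU : IsCompact U) (hU' : U.Nonempty)
    (hf : JointlyContinuousOn W U f) (c : ℝ) :
    P.real {ω | minMax W U (fun w u => X ω (w, u) + f w u) ≤ c}
      ≤ 2 ^ M * P'.real {ω | minMax W U (fun w u => Y ω (w, u) + f w u) ≤ c} :=
  measureReal_le_le_of_forall_lt (hY.aemeasurable_minMax hYc hW hW' hU hU' hf)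
    (measureReal_minMax_lt_le hS hT hX hY hXc hYc hW hW' hU hU' hf) c

lemma primaryCov_swap (q q' : (Fin n → ℝ) × (Fin p → ℝ)) :
    primaryCov S T q.swap q'.swap = primaryCov T S q q' :=
  Finset.sum_congr rfl fun _ _ => mul_comm _ _

lemma auxiliaryCov_swap (q q' : (Fin n → ℝ) × (Fin p → ℝ)) :
    auxiliaryCov S T q.swap q'.swap = auxiliaryCov T S q q' :=
  Finset.sum_congr rfl fun _ _ => by
    simp only [Prod.fst_swap, Prod.snd_swap]
    ring

/-- The upper tail of a convex-concave problem is the lower tail of the dual problem. -/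
theorem measureReal_lt_minMax_le (hS : ∀ l, (S l).PosSemidef) (hT : ∀ l, (T l).PosSemidef)
    (hX : IsCenteredGaussianProcess P X (primaryCov S T))
    (hY : IsCenteredGaussianProcess P' Y (auxiliaryCov S T))
    (hXc : ∀ ω, Continuous (X ω)) (hYc : ∀ ω, Continuous (Y ω))
    (hW : IsCompact W) (hW' : W.Nonempty) (hU : IsCompact U) (hU' : U.Nonempty)
    (hf : JointlyContinuousOn W U f)
    (hcx : ∀ ω, ∀ u ∈ U, ConvexOn ℝ W fun w => X ω (w, u) + f w u)
    (hcv : ∀ ω, ∀ w ∈ W, ConcaveOn ℝ U fun u => X ω (w, u) + f w u) (c : ℝ) :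
    P.real {ω | c < minMax W U (fun w u => X ω (w, u) + f w u)}
      ≤ 2 ^ M * P'.real {ω | c < minMax W U (fun w u => Y ω (w, u) + f w u)} := by
  -- The roles of `(W, S)` and `(U, T)` are exchanged and both processes negated; a centred Gaussian
  -- process keeps its covariance under negation.
  have h := measureReal_minMax_lt_le hT hS
    ((hX.comp (Prod.swap (α := Fin n → ℝ) (β := Fin p → ℝ))).neg.congr primaryCov_swap)
    ((hY.comp (Prod.swap (α := Fin n → ℝ) (β := Fin p → ℝ))).neg.congr auxiliaryCov_swap)
    (fun ω => ((hXc ω).comp continuous_swap).neg) (fun ω => ((hYc ω).comp continuous_swap).neg)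
    hU hU' hW hW' hf.neg_swap (-c)
  simp only [Prod.swap_prod_mk, ← neg_add] at h
  refine le_trans (measureReal_mono fun ω hω => ?_) (h.trans ?_)
  -- Strong duality is needed only for the primary problem.
  · have := minMax_le_neg_minMax_swap hW hW' hU hU' ((hXc ω).continuousOn.add hf) (hcx ω) (hcv ω)
    exact lt_neg.1 (lt_of_lt_of_le hω this)
  · refine mul_le_mul_of_nonneg_left (measureReal_mono fun ω hω => ?_) (by positivity)
    -- Weak duality suffices here, so no convexity of the auxiliary loss enters.
    have := neg_minMax_swap_le (L := fun w u => Y ω (w, u) + f w u) hW hW' hU hU' ((hYc ω).continuousOn.add hf)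
    exact lt_of_lt_of_le (lt_neg.1 hω) this

theorem measureReal_le_minMax_le (hS : ∀ l, (S l).PosSemidef) (hT : ∀ l, (T l).PosSemidef)
    (hX : IsCenteredGaussianProcess P X (primaryCov S T))
    (hY : IsCenteredGaussianProcess P' Y (auxiliaryCov S T))
    (hXc : ∀ ω, Continuous (X ω)) (hYc : ∀ ω, Continuous (Y ω))
    (hW : IsCompact W) (hW' : W.Nonempty) (hU : IsCompact U) (hU' : U.Nonempty)
    (hf : JointlyContinuousOn W U f)
    (hcx : ∀ ω, ∀ u ∈ U, ConvexOn ℝ W fun w => X ω (w, u) + f w u)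
    (hcv : ∀ ω, ∀ w ∈ W, ConcaveOn ℝ U fun u => X ω (w, u) + f w u) (c : ℝ) :
    P.real {ω | c ≤ minMax W U (fun w u => X ω (w, u) + f w u)}
      ≤ 2 ^ M * P'.real {ω | c ≤ minMax W U (fun w u => Y ω (w, u) + f w u)} := by
  have h := measureReal_le_le_of_forall_lt (P := P) (C := 2 ^ M)
    (Ψ := fun ω => -minMax W U (fun w u => X ω (w, u) + f w u))
    (hY.aemeasurable_minMax hYc hW hW' hU hU' hf).neg (fun c' => ?_) (-c)
  · simpa only [Pi.neg_apply, neg_le_neg_iff] using h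
  · simpa only [Pi.neg_apply, neg_lt] using
      measureReal_lt_minMax_le hS hT hX hY hXc hYc hW hW' hU hU' hf hcx hcv (-c')

end Comparison

end DependentCGMT

end

/-! ### Assembly: tails, concentration and localization of the minimizer -/

theorem mainTheorem3
    {Ω Ω' : Type*} [MeasurableSpace Ω] [MeasurableSpace Ω']
    (P : Measure Ω) [IsProbabilityMeasure P] (P' : Measure Ω') [IsProbabilityMeasure P']
    {p n M : ℕ}
    (S : Fin M → Matrix (Fin p) (Fin p) ℝ) (hS : ∀ l, (S l).PosSemidef)
    (T : Fin M → Matrix (Fin n) (Fin n) ℝ) (hT : ∀ l, (T l).PosSemidef)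
    (H : Ω → Matrix (Fin p) (Fin n) ℝ) (hH : DependentCGMT.IsLowRankGaussian P S T H)
    (h : Ω' → Fin M → Fin n → ℝ) (g : Ω' → Fin M → Fin p → ℝ)
    (hhg : DependentCGMT.IsIndepStdGaussian P' h g)
    (Sw : Set (Fin p → ℝ)) (hSw : IsCompact Sw) (hSw_ne : Sw.Nonempty)
    (Su : Set (Fin n → ℝ)) (hSu : IsCompact Su) (hSu_ne : Su.Nonempty)
    (f : (Fin p → ℝ) → (Fin n → ℝ) → ℝ)
    (hf : ContinuousOn (fun x : (Fin p → ℝ) × (Fin n → ℝ) => f x.1 x.2) (Sw ×ˢ Su)) :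
    let Ψ : Ω → ℝ := fun ω => DependentCGMT.minMax Sw Su (DependentCGMT.primaryLoss f (H ω))
    let ψ : Set (Fin p → ℝ) → Ω' → ℝ := fun W ω =>
      DependentCGMT.minMax W Su (DependentCGMT.auxiliaryLoss S T f (h ω) (g ω))
    (∀ c : ℝ, P.real {ω | Ψ ω ≤ c} ≤ 2 ^ M * P'.real {ω | ψ Sw ω ≤ c}) ∧
    (Convex ℝ Sw → Convex ℝ Su →
      (∀ u ∈ Su, ConvexOn ℝ Sw (fun w => f w u)) →
      (∀ w ∈ Sw, ConcaveOn ℝ Su (fun u => f w u)) →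
      (∀ c : ℝ, P.real {ω | c ≤ Ψ ω} ≤ 2 ^ M * P'.real {ω | c ≤ ψ Sw ω}) ∧
      (∀ μ t : ℝ, 0 < t →
        P.real {ω | t ≤ |Ψ ω - μ|} ≤ 2 ^ M * P'.real {ω | t ≤ |ψ Sw ω - μ|}) ∧
      (∀ A : Set (Fin p → ℝ), (∃ U : Set (Fin p → ℝ), IsOpen U ∧ A = U ∩ Sw) →
        ∀ ψS ψA η ε : ℝ, 0 < η → 0 < ε →
          ψS + 3 * η ≤ ψA →
          1 - ε ≤ P'.real {ω | ψ Sw ω ≤ ψS + η} →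
          1 - ε ≤ P'.real {ω | ψA - η ≤ ψ (Sw \ A) ω} →
          ∀ wHat : Ω → Fin p → ℝ,
            (∀ᵐ ω ∂P, wHat ω ∈ Sw ∧
              IsMinOn (DependentCGMT.innerMax Su (DependentCGMT.primaryLoss f (H ω))) Sw
                (wHat ω)) →
            1 - 2 ^ (M + 1) * ε ≤ P.real {ω | wHat ω ∈ A})) := by
  intro Ψ ψ
  have hX := DependentCGMT.isCenteredGaussianProcess_primary hH
  have hY := DependentCGMT.isCenteredGaussianProcess_auxiliary hS hT hhg
  have hXc : ∀ ω, Continuous fun q : (Fin p → ℝ) × (Fin n → ℝ) => q.1 ⬝ᵥ (H ω *ᵥ q.2) := fun ω => by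
    unfold dotProduct; fun_prop
  have hYc := fun ω => DependentCGMT.continuous_auxiliaryProcess S T (h ω) (g ω)
  have lower : ∀ c : ℝ, P.real {ω | Ψ ω ≤ c} ≤ 2 ^ M * P'.real {ω | ψ Sw ω ≤ c} := by
    have := DependentCGMT.measureReal_minMax_le_le hS hT hX hY hXc hYc hSw hSw_ne hSu hSu_ne hf
    exact this
  refine ⟨lower, fun hcSw hcSu hcx hcv => ?_⟩
  have hcx' : ∀ ω, ∀ u ∈ Su, ConvexOn ℝ Sw fun w => w ⬝ᵥ (H ω *ᵥ u) + f w u := fun ω u hu =>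
    ConvexOn.add (f := fun w => w ⬝ᵥ (H ω *ᵥ u)) ⟨hcSw, fun x _ y _ a b _ _ _ => by
      beta_reduce
      rw [add_dotProduct, smul_dotProduct, smul_dotProduct]⟩ (hcx u hu)
  have hcv' : ∀ ω, ∀ w ∈ Sw, ConcaveOn ℝ Su fun u => w ⬝ᵥ (H ω *ᵥ u) + f w u := fun ω w hw =>
    ConcaveOn.add (f := fun u => w ⬝ᵥ (H ω *ᵥ u)) ⟨hcSu, fun x _ y _ a b _ _ _ => by
      beta_reduce
      rw [mulVec_add, dotProduct_add, mulVec_smul, mulVec_smul, dotProduct_smul, dotProduct_smul]⟩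
      (hcv w hw)
  have upper : ∀ c : ℝ, P.real {ω | c ≤ Ψ ω} ≤ 2 ^ M * P'.real {ω | c ≤ ψ Sw ω} := by
    have := DependentCGMT.measureReal_le_minMax_le hS hT hX hY hXc hYc hSw hSw_ne hSu hSu_ne hf hcx'
      hcv'
    exact this
  have hψm : AEMeasurable (ψ Sw) P' := by
    have := hY.aemeasurable_minMax hYc hSw hSw_ne hSu hSu_ne hf
    exact this
  refine ⟨upper, fun μ t ht => ?_, ?_⟩
  · have e : ∀ x : ℝ, t ≤ |x - μ| ↔ x ≤ μ - t ∨ μ + t ≤ x := fun x => by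
      rw [le_abs']
      constructor <;> rintro (h | h)
      exacts [.inl (by linarith), .inr (by linarith), .inl (by linarith), .inr (by linarith)]
    simp only [e, Set.ofPred_or]
    -- Disjointness makes the auxiliary probabilities add exactly; on the primary side a union bound
    -- is enough.
    have hdisj : Disjoint {ω | ψ Sw ω ≤ μ - t} {ω | μ + t ≤ ψ Sw ω} :=
      Set.disjoint_left.2 fun ω (h1 : ψ Sw ω ≤ μ - t) (h2 : μ + t ≤ ψ Sw ω) => by linarith
    rw [measureReal_union₀ (nullMeasurableSet_le aemeasurable_const hψm) hdisj.aedisjoint, mul_add]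
    exact (measureReal_union_le _ _).trans (add_le_add (lower _) (upper _))
  · rintro A ⟨V, hV, rfl⟩ ψS ψA η ε hη hε hgap h1 h2 wHat hwHat
    have hdiff : Sw \ (V ∩ Sw) = Sw \ V := by ext; simp +contextual
    rw [hdiff] at h2
    -- For an empty complement the infimum is a default value and carries no information, but then
    -- `wHat` lies in `A` almost surely.
    rcases (Sw \ V).eq_empty_or_nonempty with hempty | hne
    · have hsub : Sw ⊆ V := Set.sdiff_eq_empty.1 hempty
      have hone : P.real {ω | wHat ω ∈ V ∩ Sw} = 1 := by
        rw [measureReal_congr (Filter.eventuallyEq_univ.2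
          (hwHat.mono fun ω hω => ⟨hsub hω.1, hω.1⟩)), probReal_univ]
      rw [hone]
      have : (0 : ℝ) ≤ 2 ^ (M + 1) * ε := by positivity
      linarith
    · have hcomp : IsCompact (Sw \ V) := hSw.diff hV
      have hfV : DependentCGMT.JointlyContinuousOn (Sw \ V) Su f :=
        hf.mono (Set.prod_mono_left Set.sdiff_subset)
      have hψV : AEMeasurable (ψ (Sw \ V)) P' := by
        have := hY.aemeasurable_minMax hYc hcomp hne hSu hSu_ne hfV
        exact this
      -- The upper tail over `Sw`, where convexity is used.
      have hB1 : P.real {ω | ψS + η < Ψ ω} ≤ 2 ^ M * ε := by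
        have hlt := DependentCGMT.measureReal_lt_minMax_le hS hT hX hY hXc hYc hSw hSw_ne hSu hSu_ne
          hf hcx' hcv' (ψS + η)
        refine le_trans (by exact hlt) (mul_le_mul_of_nonneg_left ?_ (by positivity))
        have := measureReal_add_measureReal_compl₀
          (nullMeasurableSet_le hψm (aemeasurable_const (b := ψS + η)))
        rw [probReal_univ] at this
        have hc : {ω | ψ Sw ω ≤ ψS + η}ᶜ = {ω | ψS + η < ψ Sw ω} := by ext; simp
        rw [hc] at this
        change P'.real {ω | ψS + η < ψ Sw ω} ≤ ε
        linarith
      -- The lower tail over `Sw \ V`, which is compact because `V` is open but need not be convex.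
      have hB2 : P.real {ω | DependentCGMT.minMax (Sw \ V) Su (DependentCGMT.primaryLoss f (H ω))
          < ψA - η} ≤ 2 ^ M * ε := by
        have hlt := DependentCGMT.measureReal_minMax_lt_le hS hT hX hY hXc hYc hcomp hne hSu hSu_ne
          hfV (ψA - η)
        refine le_trans (by exact hlt) (mul_le_mul_of_nonneg_left ?_ (by positivity))
        have := measureReal_add_measureReal_compl₀
          (nullMeasurableSet_le (aemeasurable_const (b := ψA - η)) hψV)
        rw [probReal_univ] at this
        have hc : {ω | ψA - η ≤ ψ (Sw \ V) ω}ᶜ = {ω | ψ (Sw \ V) ω < ψA - η} :=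
          Set.ext fun _ => by simp only [Set.mem_compl_iff, Set.mem_ofPred_eq, not_le]
        rw [hc] at this
        change P'.real {ω | ψ (Sw \ V) ω < ψA - η} ≤ ε
        linarith
      -- No measurability of `wHat` is available, so its event is bounded by covering almost all of
      -- the space and using subadditivity, not by taking complements. Off the two bad events, `wHat
      -- ∉ A` would give `ψA - η ≤ Ψ ≤ ψS + η`, against the gap `3η`.
      have hcover : (1 : ℝ) ≤ P.real ({ω | wHat ω ∈ V ∩ Sw} ∪ ({ω | ψS + η < Ψ ω} ∪
          {ω | DependentCGMT.minMax (Sw \ V) Su (DependentCGMT.primaryLoss f (H ω)) < ψA - η})) := by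
        rw [measureReal_congr (Filter.eventuallyEq_univ.2 ?_), probReal_univ]
        · filter_upwards [hwHat] with ω hω
          by_contra hcon
          simp only [Set.mem_union, Set.mem_ofPred_eq, not_or, not_lt] at hcon
          obtain ⟨hA, hB, hC⟩ := hcon
          have hmem : wHat ω ∈ Sw \ V := ⟨hω.1, fun hVω => hA ⟨hVω, hω.1⟩⟩
          have hle1 : DependentCGMT.innerMax Su (DependentCGMT.primaryLoss f (H ω)) (wHat ω) ≤ Ψ ω :=
            DependentCGMT.le_minMax hSw_ne fun w hw => hω.2 hw
          have hle2 := DependentCGMT.minMax_le_innerMax (L := DependentCGMT.primaryLoss f (H ω))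
            hcomp hSu hSu_ne ((hXc ω).continuousOn.add hfV) hmem
          linarith
      have h3 := measureReal_union_le (μ := P) {ω | wHat ω ∈ V ∩ Sw} ({ω | ψS + η < Ψ ω} ∪
          {ω | DependentCGMT.minMax (Sw \ V) Su (DependentCGMT.primaryLoss f (H ω)) < ψA - η})
      have h4 := measureReal_union_le (μ := P) {ω | ψS + η < Ψ ω}
          {ω | DependentCGMT.minMax (Sw \ V) Su (DependentCGMT.primaryLoss f (H ω)) < ψA - η}
      rw [pow_succ]
      linarith
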